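/- Let $n\ge 0$, let $S_n$ be the symmetric group, whose elements are written as words $w=w_1\dots w_n$ with $w_i=w(i)$, and put $w_0=0$. The peak set of $w\in S_n$ is $\mathrm{Peak}(w)=\{i\in\{1,\dots,n-1\} : w_{i-1}<w_i>w_{i+1}\}$ (so that $1$ may be a peak). Let $\mathcal F_n$ be the collection of the subsets of $\{1,\dots,n-1\}$ that contain no two consecutive integers, and let $f_n=\#\mathcal F_n$; this is the Fibonacci number given by $f_0=f_1=1$, $f_n=f_{n-1}+f_{n-2}$. For $F\in\mathcal F_n$ let $P_F=\sum_{\mathrm{Peak}(w)=F}w$ in the group algebra $\mathbb Q S_n$, and let $\mathfrak P_n$ be the linear span of the $P_F$, $F\in\mathcal F_n$. For a finite Coxeter system $(W,S)$ with length function $\ell$, put $\mathrm{Des}(w)=\{s\in S:\ell(ws)<\ell(w)\}$ and $Y_J=\sum_{\mathrm{Des}(w)=J}w\in\mathbb Q W$ for $J\subseteq S$. The descent algebra of $(W,S)$ is the linear span of the elements $Y_J$, $J\subseteq S$, in $\mathbb Q W$. Let $\Sigma(A_{n-1})$, $\Sigma(B_n)$ and $\Sigma(D_n)$ be the descent algebras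 of the following groups: - the symmetric group $S_n$, with the generators $s_i=(i,i+1)$, $1\le i\le n-1$; - the group $B_n=\mathbb Z_2^n\rtimes S_n$ of signed permutations, in which a letter with negative sign is marked by a bar, with the generators $s_i$, $1\le i\le n-1$, and (if $n\ge1$) $s_0=\bar 1\,2\dots n$; - the group $D_n\subseteq B_n$ of signed permutations with an even number of bars, with the generators $s_i$, $1\le i\le n-1$, and (if $n\ge 2$) $s_{1'}=\bar2\,\bar1\,3\dots n$. Let $\varphi:\mathbb Q B_n\to\mathbb Q S_n$ be the linear extension of the homomorphism $B_n\to S_n$ that forgets the signs, and let $\psi:\mathbb Q D_n\to\mathbb Q S_n$ be its restriction. **Theorem.** $\mathfrak P_n$ is contained in $\Sigma(A_{n-1})$, contains the unit element and is closed under multiplication; that is, it is a unital subalgebra of the descent algebra of $S_n$. Its dimension is $f_n$. Moreover, $\varphi(\Sigma(B_n))=\mathfrak P_n$ and $\psi(\Sigma(D_n))=\mathfrak P_n$. -/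

import Mathlib

noncomputable section

namespace PeakAlgebra

/-! ## Descent algebras

`W` is a group with a set `S` of generators which are involutions (in the applications `(W, S)` is
a finite Coxeter system), so that every element of `W` is a product of elements of `S`. -/

/-- `ℓ(w)`: the least number of factors in an expression of `w` as a product of elements of `S`. -/
def length {W : Type*} [Group W] (S : Set W) (w : W) : ℕ :=
  sInf {k | ∃ l : List W, (∀ s ∈ l, s ∈ S) ∧ l.prod = w ∧ l.length = k}

/-- `Des(w) = {s ∈ S | ℓ(ws) < ℓ(w)}`. -/
def Des {W : Type*} [Group W] (S : Set W) (w : W) : Set W :=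
  {s | s ∈ S ∧ length S (w * s) < length S w}

open scoped Classical in
/-- `Y_J`: the sum in `ℚ W` of the elements whose descent set is `J`. -/
def Y {W : Type*} [Group W] [Fintype W] (S J : Set W) : MonoidAlgebra ℚ W :=
  ∑ w with Des S w = J, MonoidAlgebra.of ℚ W w

/-- The descent algebra of `(W, S)`: the linear span of the `Y_J`, for `J ⊆ S`. -/
def descentAlgebra {W : Type*} [Group W] [Fintype W] (S : Set W) :
    Submodule ℚ (MonoidAlgebra ℚ W) :=
  Submodule.span ℚ {y | ∃ J ⊆ S, y = Y S J}

/-! ## The groups of types A, B, D and their Coxeter generators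

`Fin n` stands for the symbols `1, …, n` (the symbol `k` is the element of value `k - 1`). -/

/-- The elementary transpositions `s_i = (i, i+1)`, `1 ≤ i ≤ n - 1`, of the symmetric group. -/
def generatorsA (n : ℕ) : Set (Equiv.Perm (Fin n)) :=
  {w | ∃ i j : Fin n, (i : ℕ) + 1 = j ∧ w = Equiv.swap i j}

/-- The group of signed permutations `ℤ₂ⁿ ⋊ S_n`. The pair `(ε, σ)` is the signed permutation
`w_1 … w_n` in which `w_i` is the symbol `σ i`, barred if and only if `ε (σ i) = -1`. -/
abbrev SignedPerm (n : ℕ) : Type :=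
  SemidirectProduct (Fin n → ℤˣ) (Equiv.Perm (Fin n)) mulAutArrow

instance (n : ℕ) : Fintype (SignedPerm n) :=
  Fintype.ofEquiv _ SemidirectProduct.equivProd.symm

/-- The elementary transpositions, with no bars, and (for `n ≥ 1`) the signed permutation
`s_0` that is obtained from the identity by putting a bar over the symbol `1`. -/
def generatorsB (n : ℕ) : Set (SignedPerm n) :=
  {w | ∃ s ∈ generatorsA n, w = SemidirectProduct.inr s} ∪
  {w | ∃ i : Fin n, (i : ℕ) = 0 ∧ w = SemidirectProduct.inl (Pi.mulSingle i (-1))}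

/-- The subgroup of the signed permutations with an even number of bars. -/
def evenSignedPerm (n : ℕ) : Subgroup (SignedPerm n) where
  carrier := {w | ∏ i, w.left i = 1}
  one_mem' := by simp
  mul_mem' := by
    intro a b ha hb
    have h : ∏ i, (mulAutArrow a.right b.left) i = ∏ i, b.left i :=
      Equiv.prod_comp (a.right⁻¹) b.left
    simp only [Set.mem_ofPred_eq, SemidirectProduct.mul_left, Pi.mul_apply,
      Finset.prod_mul_distrib] at *
    rw [h, ha, hb, one_mul]
  inv_mem' := by
    intro a ha
    have h : ∏ i, (mulAutArrow a.right⁻¹ a.left⁻¹) i = ∏ i, a.left⁻¹ i :=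
      Equiv.prod_comp (a.right⁻¹⁻¹) a.left⁻¹
    simp only [Set.mem_ofPred_eq, SemidirectProduct.inv_left] at *
    rw [h]
    simp [ha]

open scoped Classical in
instance (n : ℕ) : Fintype (evenSignedPerm n) :=
  Fintype.ofFinite _

/-- The elementary transpositions, with no bars, and (for `n ≥ 2`) the signed permutation
`s_{1'}` that is obtained from the identity by exchanging the symbols `1` and `2` and putting
bars over both. -/
def generatorsD (n : ℕ) : Set (evenSignedPerm n) :=
  {w | ∃ s ∈ generatorsA n, (w : SignedPerm n) = SemidirectProduct.inr s} ∪
  {w | ∃ i j : Fin n, (i : ℕ) = 0 ∧ (j : ℕ) = 1 ∧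
    (w : SignedPerm n) = ⟨Pi.mulSingle i (-1) * Pi.mulSingle j (-1), Equiv.swap i j⟩}

/-- `φ`: the linear extension to group algebras of the map that forgets the signs. -/
def phi (n : ℕ) : MonoidAlgebra ℚ (SignedPerm n) →ₐ[ℚ] MonoidAlgebra ℚ (Equiv.Perm (Fin n)) :=
  MonoidAlgebra.mapDomainAlgHom ℚ ℚ SemidirectProduct.rightHom

/-- `ψ`: the linear extension to group algebras of the restriction to the even signed permutations
of the map that forgets the signs. -/
def psi (n : ℕ) :
    MonoidAlgebra ℚ (evenSignedPerm n) →ₐ[ℚ] MonoidAlgebra ℚ (Equiv.Perm (Fin n)) :=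
  MonoidAlgebra.mapDomainAlgHom ℚ ℚ (SemidirectProduct.rightHom.comp (evenSignedPerm n).subtype)

/-! ## Peaks -/

/-- The `i`-th letter of the word `w_1 … w_n` in the letters `1, …, n`, where `w_0 = 0`
(only positions `0 ≤ i ≤ n` are used). -/
def letter {n : ℕ} (w : Equiv.Perm (Fin n)) (i : ℕ) : ℕ :=
  if h : 1 ≤ i ∧ i ≤ n then (w ⟨i - 1, by omega⟩ : ℕ) + 1 else 0

/-- `Peak(w) = {i ∈ {1, …, n - 1} | w_{i-1} < w_i > w_{i+1}}`, where `w_0 = 0`. -/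
def Peak {n : ℕ} (w : Equiv.Perm (Fin n)) : Finset ℕ :=
  {i ∈ Finset.Icc 1 (n - 1) | letter w (i - 1) < letter w i ∧ letter w (i + 1) < letter w i}

/-- The collection of the subsets `F` of `{1, …, n - 1}` that contain no two consecutive
integers. -/
def sparseSets (n : ℕ) : Finset (Finset ℕ) :=
  {F ∈ (Finset.Icc 1 (n - 1)).powerset | ∀ i ∈ F, i + 1 ∉ F}

/-- `P_F`: the sum of the permutations whose set of peaks is `F`. -/
def P (n : ℕ) (F : Finset ℕ) : MonoidAlgebra ℚ (Equiv.Perm (Fin n)) :=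
  ∑ w with Peak w = F, MonoidAlgebra.of ℚ (Equiv.Perm (Fin n)) w

/-- The linear span of the `P_F`. -/
def peakAlgebra (n : ℕ) : Submodule ℚ (MonoidAlgebra ℚ (Equiv.Perm (Fin n))) :=
  Submodule.span ℚ {p | ∃ F ∈ sparseSets n, p = P n F}

end PeakAlgebra

end

/-!
All the spaces involved consist of the elements of a group algebra whose coefficients depend only on
a statistic of the group elements (`fiberConst`): the descent set for the descent algebras, the peak
set for `𝔓_n`. As the descent set of a permutation determines its peak set, `𝔓_n` is contained in
`Σ(A_{n-1})`; the dimension of `𝔓_n` is the number of sets which occur as peak sets.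

*Descents.* `mem_Des_iff_of_statistic` identifies the length with an inversion statistic, and with
it the abstract descents with those read off from words. The statistic `pairStat` serves all three
types.

*Type `B`.* For `σ ∈ S_n` and a set `J` of positions, the coefficient of `φ(Y_J)` at `σ` is the
number of signings of `σ` with descent set `J`. At each step of the word, the larger one of the two
letters of `σ` alone decides, by its sign, whether there is a descent. So the sign of a letter on a
peak is subject to two conditions, which are compatible if and only if exactly one of `i - 1`, `i`
is in `J`, the sign of a letter in a valley is free, and any other sign is determined. There are as
many valleys as peaks, so that
`φ(Y_J) = ∑ 2 ^ #F • P_F`, over the `F` all of whose elements `i` satisfy this condition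
(`card_signings`). The condition is `F ⊆ T` for a set `T` that can be prescribed, and by
triangularity the `φ(Y_J)` span `𝔓_n`.

*Multiplication.* Since `φ` is a homomorphism of algebras, it remains to show that `Σ(B_n)` is
closed under multiplication, which is Solomon's theorem. The number of factorizations `w = u u'`
with `Des u ⊆ J` and `Des u' ⊆ K` has to be a function of `Des w`. Let `λ_J` be the vector in the closed
fundamental chamber with jumps at the positions in `J`. Then `Des u ⊆ J` means that a large multiple
of `λ_J`, perturbed by the word of `u`, lies in the open fundamental chamber. In terms of the vector
`μ = w⁻¹ u λ_J`, which runs through the orbit of `λ_J`, the two conditions together say that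
`N (N' λ_K + μ)`, perturbed by the word of `w`, lies in the open chamber (`card_factorizations`),
and of the word of `w` only its descents matter for this.

*Type `D`.* The sign of the letter `1` is irrelevant for the descents in type `D`, so that half of
the signings of `σ` with given descents are even. Comparison of the descents in the types `B` and
`D` expresses each `ψ(Y_J)` by at most two of the `φ(Y_J)` (`psiY_eq`), and conversely.
-/

namespace PeakAlgebra

/-! ### Elements with coefficients constant on the fibres of a statistic -/

section FiberConst

variable {G ι : Type*}

/-- The elements `a` of the group algebra whose coefficient at `x` depends only on `d x`. -/
def fiberConst (d : G → ι) : Submodule ℚ (MonoidAlgebra ℚ G) where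
  carrier := {a | ∀ x y, d x = d y → a.coeff x = a.coeff y}
  add_mem' := by
    intro a b ha hb x y h
    simp [ha x y h, hb x y h]
  zero_mem' := by intro x y _; simp
  smul_mem' := by
    intro c a ha x y h
    simp [ha x y h]

lemma mem_fiberConst {d : G → ι} {a : MonoidAlgebra ℚ G} :
    a ∈ fiberConst d ↔ ∀ x y, d x = d y → a.coeff x = a.coeff y := Iff.rfl

lemma fiberConst_congr {κ : Type*} {d : G → ι} {e : G → κ} (h : ∀ x y, d x = d y ↔ e x = e y) :
    fiberConst d = fiberConst e := by
  ext a
  simp only [mem_fiberConst, h]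

/-- The sum in the group algebra of the elements of a finite set. -/
noncomputable def setSum [Group G] (s : Finset G) : MonoidAlgebra ℚ G :=
  ∑ x ∈ s, MonoidAlgebra.of ℚ G x

lemma coeff_setSum [Group G] [DecidableEq G] (s : Finset G) (x : G) :
    (setSum s).coeff x = if x ∈ s then 1 else 0 := by
  simp [setSum, MonoidAlgebra.coeff_sum, Finsupp.finsetSum_apply, MonoidAlgebra.coeff_single,
    Finsupp.single_apply]

lemma coeff_setSum_filter [Group G] [Fintype G] (p : G → Prop) [DecidablePred p] (x : G) :
    (setSum (Finset.univ.filter p)).coeff x = if p x then 1 else 0 := by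
  classical
  simp [coeff_setSum]

lemma setSum_fiber_mem_fiberConst [Group G] [Fintype G] [DecidableEq ι] (d : G → ι) (i : ι) :
    setSum {x | d x = i} ∈ fiberConst d := by
  intro x y h
  simp [coeff_setSum_filter, h]

lemma eq_sum_setSum_fiber [Group G] [Fintype G] [DecidableEq ι] {d : G → ι} {a : MonoidAlgebra ℚ G}
    (c : ι → ℚ) (hc : ∀ x, c (d x) = a.coeff x) (s : Finset ι)
    (hs : ∀ x, d x ∈ s) : a = ∑ i ∈ s, c i • setSum {x | d x = i} := by
  ext x
  simp [MonoidAlgebra.coeff_sum, Finsupp.finsetSum_apply, coeff_setSum_filter, hs, hc]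

lemma span_setSum_fiber [Group G] [Fintype G] [DecidableEq ι] (d : G → ι) (p : ι → Prop)
    (hp : ∀ x, p (d x)) :
    Submodule.span ℚ {y | ∃ i, p i ∧ y = setSum {x | d x = i}} = fiberConst d := by
  apply le_antisymm
  · rw [Submodule.span_le]
    rintro _ ⟨i, -, rfl⟩
    exact setSum_fiber_mem_fiberConst d i
  · intro a ha
    have hc : ∀ x, Function.extend d (fun x => a.coeff x) 0 (d x) = a.coeff x := by
      intro x
      have hf : Function.FactorsThrough (fun x => a.coeff x) d := fun x y h => ha x y h
      exact hf.extend_apply 0 x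
    rw [eq_sum_setSum_fiber _ hc (Finset.univ.image d) (by simp)]
    refine Submodule.sum_mem _ fun i hi => Submodule.smul_mem _ _ (Submodule.subset_span ?_)
    obtain ⟨x, -, rfl⟩ := Finset.mem_image.1 hi
    exact ⟨d x, hp x, rfl⟩

lemma coeff_setSum_mul [Group G] [Fintype G] (p q : G → Prop) [DecidablePred p]
    [DecidablePred q] (w : G) :
    (setSum (Finset.univ.filter p) * setSum (Finset.univ.filter q)).coeff w =
      (Finset.univ.filter fun u : G => p u ∧ q (u⁻¹ * w)).card := by
  classical
  rw [setSum, Finset.sum_mul, MonoidAlgebra.coeff_sum, Finsupp.finsetSum_apply,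
    Finset.card_filter, Finset.sum_filter, Nat.cast_sum]
  refine Finset.sum_congr rfl fun u _ => ?_
  by_cases hu : p u
  · simp [hu, MonoidAlgebra.of_apply, MonoidAlgebra.coeff_single_mul_apply, coeff_setSum_filter]
  · simp [hu]

lemma coeff_map_setSum [Group G] {H : Type*} [Group H] [DecidableEq H] (f : G →* H)
    (s : Finset G) (y : H) :
    (MonoidAlgebra.mapDomainAlgHom ℚ ℚ f (setSum s)).coeff y =
      (s.filter fun x => f x = y).card := by
  simp [setSum, MonoidAlgebra.coeff_sum, Finsupp.finsetSum_apply, MonoidAlgebra.coeff_single,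
    Finsupp.single_apply]

end FiberConst

lemma Y_eq_setSum {W : Type*} [Group W] [Fintype W] (S J : Set W)
    [DecidablePred fun w => Des S w = J] : Y S J = setSum {w | Des S w = J} := by
  unfold Y setSum
  congr!

lemma descentAlgebra_eq_fiberConst {W : Type*} [Group W] [Fintype W] (S : Set W) :
    descentAlgebra S = fiberConst (Des S) := by
  classical
  rw [← span_setSum_fiber (Des S) (fun J => J ⊆ S) (fun w s hs => hs.1), descentAlgebra]
  simp only [Y_eq_setSum]

lemma Peak_mem_sparseSets {n : ℕ} (w : Equiv.Perm (Fin n)) : Peak w ∈ sparseSets n := by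
  simp only [sparseSets, Finset.mem_filter, Finset.mem_powerset, Peak]
  refine ⟨Finset.filter_subset _ _, fun i hi hi' => ?_⟩
  simp only [Nat.add_sub_cancel] at hi hi'
  omega

lemma peakAlgebra_eq_fiberConst (n : ℕ) : peakAlgebra n = fiberConst (Peak (n := n)) := by
  rw [← span_setSum_fiber (Peak (n := n)) (fun F => F ∈ sparseSets n) Peak_mem_sparseSets]
  rfl

/-! ### Descents and lengths -/

lemma length_le_of_prod {W : Type*} [Group W] {S : Set W} {l : List W} (h : ∀ s ∈ l, s ∈ S) :
    length S l.prod ≤ l.length :=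
  Nat.sInf_le ⟨l, h, rfl, rfl⟩

/-- If `N 1 = 0`, if `N` changes by one under right multiplication by a generator `g k`, downwards
if and only if `k ∈ D w`, and if only `w = 1` has empty `D w`, then `N` is the length. Hence `D`
gives the descents. -/
lemma mem_Des_iff_of_statistic {W : Type*} [Group W] (g : ℕ → W) (K : Set ℕ) (N : W → ℕ)
    (D : W → Finset ℕ) (hg : ∀ k ∈ K, g k * g k = 1) (h1 : N 1 = 0)
    (hD : ∀ w, ∀ k ∈ K, (k ∈ D (w * g k) ↔ k ∉ D w))
    (hN : ∀ w, ∀ k ∈ K, k ∉ D w → N (w * g k) = N w + 1)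
    (hid : ∀ w, (∀ k ∈ K, k ∉ D w) → w = 1) (w : W) (k : ℕ) (hk : k ∈ K) :
    g k ∈ Des (g '' K) w ↔ k ∈ D w := by
  have hN' : ∀ w, ∀ k ∈ K, k ∈ D w → N (w * g k) + 1 = N w := by
    intro w k hk hw
    have := hN (w * g k) k hk (by rw [hD w k hk]; simpa using hw)
    rw [mul_assoc, hg k hk, mul_one] at this
    exact this.symm
  have hup : ∀ (l : List W), (∀ s ∈ l, s ∈ g '' K) → ∀ w, N (w * l.prod) ≤ N w + l.length := by
    intro l
    induction l with
    | nil => simp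
    | cons a l ih =>
      intro hl w
      obtain ⟨k, hk, rfl⟩ := hl a (by simp)
      have h2 := ih (fun s hs => hl s (by simp [hs])) (w * g k)
      have h3 : N (w * g k) ≤ N w + 1 := by
        by_cases h : k ∈ D w
        · have := hN' w k hk h; omega
        · exact (hN w k hk h).le
      rw [List.prod_cons, ← mul_assoc, List.length_cons]
      omega
  have hex : ∀ m w, N w = m →
      ∃ l : List W, (∀ s ∈ l, s ∈ g '' K) ∧ l.prod = w ∧ l.length = m := by
    intro m
    induction m with
    | zero =>
      intro w hw
      refine ⟨[], by simp, ?_, rfl⟩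
      refine (hid w fun k hk h => ?_).symm
      have := hN' w k hk h
      omega
    | succ m ih =>
      intro w hw
      have : ∃ k ∈ K, k ∈ D w := by
        by_contra hc
        push Not at hc
        rw [hid w hc] at hw
        omega
      obtain ⟨k, hk, hkw⟩ := this
      obtain ⟨l, hl, hp, hlen⟩ := ih (w * g k) (by have := hN' w k hk hkw; omega)
      refine ⟨l ++ [g k], ?_, ?_, by simp [hlen]⟩
      · intro s hs
        rcases List.mem_append.1 hs with h | h
        · exact hl s h
        · exact ⟨k, hk, (List.mem_singleton.1 h).symm⟩
      · simp [hp, mul_assoc, hg k hk]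
  have hlen : ∀ w, length (g '' K) w = N w := by
    intro w
    apply le_antisymm
    · obtain ⟨l, hl, hp, hlen⟩ := hex _ w rfl
      rw [← hlen]
      subst hp
      exact length_le_of_prod hl
    · refine le_csInf ?_ ?_
      · obtain ⟨l, hl, hp, hlen⟩ := hex _ w rfl
        exact ⟨_, l, hl, hp, hlen⟩
      · rintro m ⟨l, hl, rfl, rfl⟩
        have := hup l hl 1
        rw [one_mul, h1] at this
        omega
  simp only [Des, Set.mem_ofPred_eq, hlen]
  constructor
  · rintro ⟨-, h⟩
    by_contra hc
    rw [hN w k hk hc] at h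
    omega
  · intro h
    refine ⟨⟨k, hk, rfl⟩, ?_⟩
    have := hN' w k hk h
    omega

/-- Descent sets of generators agree as soon as the sets of indices of these generators do. -/
lemma Des_eq_Des_iff {W : Type*} [Group W] {g : ℕ → W} {K : Set ℕ} {D : W → Finset ℕ}
    (h : ∀ w, ∀ k ∈ K, (g k ∈ Des (g '' K) w ↔ k ∈ D w)) (hDK : ∀ w, ∀ k ∈ D w, k ∈ K) (w w' : W) :
    Des (g '' K) w = Des (g '' K) w' ↔ D w = D w' := by
  constructor
  · intro e
    ext k
    constructor
    · intro hk
      have hkK := hDK _ _ hk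
      rw [← h _ _ hkK] at hk ⊢
      exact e ▸ hk
    · intro hk
      have hkK := hDK _ _ hk
      rw [← h _ _ hkK] at hk ⊢
      exact e ▸ hk
  · intro e
    ext s
    constructor
    · intro hs
      obtain ⟨k, hk, rfl⟩ := hs.1
      rw [h _ _ hk] at hs ⊢
      exact e ▸ hs
    · intro hs
      obtain ⟨k, hk, rfl⟩ := hs.1
      rw [h _ _ hk] at hs ⊢
      exact e ▸ hs

/-! ### The action of signed permutations on integer vectors -/

section Vectors

variable {n : ℕ}

/-- The coordinates of a vector, numbered `1, …, n`, preceded by a coordinate `0` equal to zero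
(and followed by zeros). -/
def extend (v : Fin n → ℤ) (k : ℕ) : ℤ := if h : 1 ≤ k ∧ k ≤ n then v ⟨k - 1, by omega⟩ else 0

@[simp] lemma extend_zero (v : Fin n → ℤ) : extend v 0 = 0 := by simp [extend]

lemma extend_succ (v : Fin n → ℤ) {k : ℕ} (h : k < n) : extend v (k + 1) = v ⟨k, h⟩ := by
  simp [extend, Nat.succ_le_of_lt h]

lemma extend_add (v v' : Fin n → ℤ) (k : ℕ) : extend (v + v') k = extend v k + extend v' k := by
  unfold extend
  split_ifs <;> simp

lemma extend_smul (c : ℤ) (v : Fin n → ℤ) (k : ℕ) : extend (c • v) k = c * extend v k := by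
  unfold extend
  split_ifs <;> simp

/-- The open fundamental chamber `0 < v_1 < … < v_n` of type `B`. -/
def Chamber (v : Fin n → ℤ) : Prop := ∀ k < n, extend v k < extend v (k + 1)

/-- The closed fundamental chamber `0 ≤ v_1 ≤ … ≤ v_n` of type `B`. -/
def ClosedChamber (v : Fin n → ℤ) : Prop := ∀ k < n, extend v k ≤ extend v (k + 1)

lemma chamber_iff (v : Fin n → ℤ) : Chamber v ↔ (∀ i, 0 < v i) ∧ StrictMono v := by
  constructor
  · intro h
    have key : ∀ l, l ≤ n → ∀ k < l, extend v k < extend v l := by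
      intro l
      induction l with
      | zero => intro _ k hk; omega
      | succ l ih =>
        intro hl k hk
        rcases Nat.lt_succ_iff_lt_or_eq.1 hk with hk | rfl
        · exact (ih (by omega) k hk).trans (h l (by omega))
        · exact h k (by omega)
    refine ⟨fun i => ?_, fun i j hij => ?_⟩
    · have := key (i + 1) i.2 0 (by omega)
      rwa [extend_zero, extend_succ v i.2] at this
    · have := key (j + 1) j.2 (i + 1) (by omega)
      rwa [extend_succ v i.2, extend_succ v j.2] at this
  · rintro ⟨h0, h1⟩ k hk
    rw [extend_succ v hk]
    cases k with
    | zero => simpa using h0 _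
    | succ k =>
      rw [extend_succ v (by omega)]
      exact h1 (by simp)

lemma closedChamber_iff (v : Fin n → ℤ) : ClosedChamber v ↔ (∀ i, 0 ≤ v i) ∧ Monotone v := by
  constructor
  · intro h
    have key : ∀ l, l ≤ n → ∀ k ≤ l, extend v k ≤ extend v l := by
      intro l
      induction l with
      | zero => intro _ k hk; simp [Nat.le_zero.1 hk]
      | succ l ih =>
        intro hl k hk
        rcases Nat.lt_or_eq_of_le hk with hk | rfl
        · exact (ih (by omega) k (by omega)).trans (h l (by omega))
        · exact le_rfl
    refine ⟨fun i => ?_, fun i j hij => ?_⟩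
    · have := key (i + 1) i.2 0 (by omega)
      rwa [extend_zero, extend_succ v i.2] at this
    · have := key (j + 1) j.2 (i + 1) (by omega)
      rwa [extend_succ v i.2, extend_succ v j.2] at this
  · rintro ⟨h0, h1⟩ k hk
    rw [extend_succ v hk]
    cases k with
    | zero => simpa using h0 _
    | succ k =>
      rw [extend_succ v (by omega)]
      exact h1 (by simp)

/-- The vector `w⁻¹ v`, where a signed permutation acts on vectors by permuting the coordinate axes
as it permutes the symbols `±1, …, ±n`. -/
def pull (w : SignedPerm n) (v : Fin n → ℤ) : Fin n → ℤ :=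
  fun i => (w.left (w.right i) : ℤ) * v (w.right i)

lemma pull_apply (w : SignedPerm n) (v : Fin n → ℤ) (i : Fin n) :
    pull w v i = (w.left (w.right i) : ℤ) * v (w.right i) := rfl

@[simp] lemma pull_one (v : Fin n → ℤ) : pull 1 v = v := by
  ext i; simp [pull]

lemma pull_mul (w x : SignedPerm n) (v : Fin n → ℤ) : pull (w * x) v = pull x (pull w v) := by
  ext i
  simp only [pull, SemidirectProduct.mul_left, SemidirectProduct.mul_right, Pi.mul_apply,
    Equiv.Perm.mul_apply, Units.val_mul]
  have : (mulAutArrow w.right x.left) (w.right (x.right i)) = x.left (x.right i) := by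
    change x.left (w.right⁻¹ • (w.right (x.right i))) = _
    simp
  rw [this]
  ring

lemma pull_add (w : SignedPerm n) (v v' : Fin n → ℤ) : pull w (v + v') = pull w v + pull w v' := by
  ext i; simp [pull, mul_add]

lemma pull_smul (w : SignedPerm n) (c : ℤ) (v : Fin n → ℤ) : pull w (c • v) = c • pull w v := by
  ext i; simp [pull, mul_left_comm]

lemma pull_injective (w : SignedPerm n) : Function.Injective (pull w) := by
  intro v v' h
  have := congrArg (pull w⁻¹) h
  simpa [← pull_mul] using this

lemma pull_pull_inv (w : SignedPerm n) (v : Fin n → ℤ) : pull w (pull w⁻¹ v) = v := by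
  rw [← pull_mul, inv_mul_cancel, pull_one]

lemma abs_pull (w : SignedPerm n) (v : Fin n → ℤ) (i : Fin n) :
    |pull w v i| = |v (w.right i)| := by
  rcases Int.units_eq_one_or (w.left (w.right i)) with h | h <;> simp [pull, h]

/-- The vector `(1, 2, …, n)`. -/
def rho (n : ℕ) : Fin n → ℤ := fun i => (i : ℤ) + 1

/-- The word `w_1 … w_n` of a signed permutation, bars being written as minus signs. -/
def word (w : SignedPerm n) : Fin n → ℤ := pull w (rho n)

lemma word_apply (w : SignedPerm n) (i : Fin n) :
    word w i = (w.left (w.right i) : ℤ) * ((w.right i : ℕ) + 1) := rfl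

lemma word_mul (w x : SignedPerm n) : word (w * x) = pull x (word w) := pull_mul w x _

lemma chamber_rho : Chamber (rho n) := by
  rw [chamber_iff]
  refine ⟨fun i => by simp only [rho]; positivity, fun i j h => ?_⟩
  simpa [rho] using h

/-- Every vector without stabilizer is moved into the open fundamental chamber by exactly one
signed permutation. -/
lemma existsUnique_chamber_pull (x : Fin n → ℤ) (h0 : ∀ i, x i ≠ 0)
    (hx : Function.Injective fun i => |x i|) : ∃! w : SignedPerm n, Chamber (pull w x) := by
  simp only [chamber_iff]
  have habs : ∀ w : SignedPerm n, (∀ i, 0 < pull w x i) →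
      pull w x = (fun i => |x i|) ∘ w.right := by
    intro w hw
    ext i
    rw [Function.comp_apply, ← abs_pull, abs_of_pos (hw i)]
  refine ⟨⟨fun k => if 0 < x k then 1 else -1, Tuple.sort fun i => |x i|⟩, ?_, ?_⟩
  · have hpos : ∀ i, 0 < pull (⟨fun k => if 0 < x k then 1 else -1,
        Tuple.sort fun i => |x i|⟩ : SignedPerm n) x i := by
      intro i
      rw [pull_apply]
      dsimp only
      split_ifs with h
      · simpa using h
      · have := h0 ((Tuple.sort fun i => |x i|) i)
        simp only [Units.val_neg, Units.val_one, neg_mul, one_mul]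
        omega
    refine ⟨hpos, ?_⟩
    rw [habs _ hpos]
    exact (Tuple.monotone_sort _).strictMono_of_injective (hx.comp (Equiv.injective _))
  · rintro ⟨ε, σ⟩ ⟨hpos, hmono⟩
    have hσ : σ = Tuple.sort fun i => |x i| := by
      have h1 := hmono.monotone
      rw [habs _ hpos] at h1
      have h2 := Tuple.unique_monotone h1 (Tuple.monotone_sort fun i => |x i|)
      ext i
      have h3 := hx (congrFun h2 i)
      simp only at h3
      rw [h3]
    refine SemidirectProduct.ext (funext fun k => ?_) hσ
    have := hpos (σ.symm k)
    simp only [pull_apply, Equiv.apply_symm_apply] at this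
    have hk := h0 k
    rcases Int.units_eq_one_or (ε k) with h | h
    · rw [h, Units.val_one, one_mul] at this
      simp [h, this]
    · rw [h, Units.val_neg, Units.val_one, neg_mul, one_mul] at this
      simp [h, not_lt.2 (neg_pos.1 this).le]

lemma eq_one_of_chamber_word {w : SignedPerm n} (h : Chamber (word w)) : w = 1 := by
  have hu := existsUnique_chamber_pull (rho n) (fun i => by simp only [rho]; positivity)
    (fun i j hij => by
      simp only [rho] at hij
      rw [abs_of_nonneg (by positivity), abs_of_nonneg (by positivity)] at hij
      exact Fin.ext (by omega))
  exact hu.unique h (by simpa using chamber_rho)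

/-- A vector is determined, in its orbit, by being in the closed fundamental chamber. -/
lemma pull_eq_self_of_closedChamber {w : SignedPerm n} {v : Fin n → ℤ} (h : ClosedChamber v)
    (h' : ClosedChamber (pull w v)) : pull w v = v := by
  rw [closedChamber_iff] at h h'
  have e : pull w v = v ∘ w.right := by
    ext i
    rw [Function.comp_apply, ← abs_of_nonneg (h.1 (w.right i)), ← abs_pull,
      abs_of_nonneg (h'.1 i)]
  have := h'.2
  rw [e] at this ⊢
  simpa using Tuple.unique_monotone (τ := 1) this (by simpa using h.2)

/-- The positions `k ∈ {0, …, n - 1}` with `w_k > w_{k+1}`, where `w_0 = 0`. -/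
def descB (w : SignedPerm n) : Finset ℕ :=
  {k ∈ Finset.range n | extend (word w) (k + 1) < extend (word w) k}

lemma mem_descB {w : SignedPerm n} {k : ℕ} :
    k ∈ descB w ↔ k < n ∧ extend (word w) (k + 1) < extend (word w) k := by
  simp [descB]

lemma abs_word (w : SignedPerm n) (i : Fin n) : |word w i| = (w.right i : ℕ) + 1 := by
  rw [word, abs_pull, rho, abs_of_nonneg (by positivity)]

lemma extend_word_ne (w : SignedPerm n) {k : ℕ} (h : k < n) :
    extend (word w) k ≠ extend (word w) (k + 1) := by
  intro e
  rw [extend_succ _ h] at e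
  have h1 := abs_word w ⟨k, h⟩
  rw [← e] at h1
  cases k with
  | zero => rw [extend_zero, abs_zero] at h1; omega
  | succ k =>
    rw [extend_succ _ (by omega), abs_word] at h1
    have h2 : (w.right ⟨k, by omega⟩) = w.right ⟨k + 1, h⟩ := Fin.ext (by omega)
    have := w.right.injective h2
    simp at this

lemma notMem_descB {w : SignedPerm n} {k : ℕ} (h : k < n) :
    k ∉ descB w ↔ extend (word w) k < extend (word w) (k + 1) := by
  have := extend_word_ne w h
  rw [mem_descB]
  constructor
  · intro h1
    have : ¬ _ := fun h2 => h1 ⟨h, h2⟩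
    omega
  · rintro h1 ⟨-, h2⟩
    omega

lemma descB_eq_empty_iff {w : SignedPerm n} : descB w = ∅ ↔ w = 1 := by
  rw [Finset.eq_empty_iff_forall_notMem]
  constructor
  · intro h
    refine eq_one_of_chamber_word fun k hk => (notMem_descB hk).1 (h k)
  · rintro rfl k hk
    have h1 := chamber_rho (n := n) k (mem_descB.1 hk).1
    have h2 := (mem_descB.1 hk).2
    rw [word, pull_one] at h2
    omega

end Vectors

/-! ### The descent algebra of type `B` is closed under multiplication -/

section Solomon

variable {n : ℕ}

lemma abs_extend_word_le (w : SignedPerm n) (k : ℕ) : |extend (word w) k| ≤ n := by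
  unfold extend
  split_ifs with h
  · rw [abs_word]
    have := (w.right ⟨k - 1, by omega⟩).2
    omega
  · simp

/-- If `N` is large, then `N v + d` lies in the open chamber if and only if `v` lies in the closed
chamber, off the walls which `d` is not on the positive side of. -/
lemma chamber_smul_add_iff (v d : Fin n → ℤ) {B N : ℤ} (hB : ∀ k, |extend d k| ≤ B)
    (hN : 2 * B < N) :
    Chamber (N • v + d) ↔ ClosedChamber v ∧
      ∀ k < n, ¬ extend d k < extend d (k + 1) → extend v k < extend v (k + 1) := by
  have hdiff : ∀ a e : ℤ, |e| ≤ 2 * B → (0 < N * a + e ↔ 0 ≤ a ∧ (¬ 0 < e → 0 < a)) := by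
    intro a e he
    rw [abs_le] at he
    constructor
    · intro h
      refine ⟨?_, fun he0 => ?_⟩ <;> by_contra hc <;> nlinarith
    · rintro ⟨h1, h2⟩
      rcases h1.eq_or_lt with rfl | h1
      · by_contra hc
        exact lt_irrefl _ (h2 (by omega))
      · nlinarith
  have hstep : ∀ k, (extend (N • v + d) k < extend (N • v + d) (k + 1) ↔
      extend v k ≤ extend v (k + 1) ∧
        (¬ extend d k < extend d (k + 1) → extend v k < extend v (k + 1))) := by
    intro k
    have hd : |extend d (k + 1) - extend d k| ≤ 2 * B := by
      refine (abs_sub _ _).trans ?_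
      have h1 := hB k
      have h2 := hB (k + 1)
      omega
    have h := hdiff (extend v (k + 1) - extend v k) _ hd
    rw [extend_add, extend_add, extend_smul, extend_smul, ← sub_pos]
    rw [show N * extend v (k + 1) + extend d (k + 1) - (N * extend v k + extend d k) =
      N * (extend v (k + 1) - extend v k) + (extend d (k + 1) - extend d k) by ring, h,
      sub_nonneg, sub_pos, sub_pos]
  constructor
  · intro h
    exact ⟨fun k hk => ((hstep k).1 (h k hk)).1, fun k hk => ((hstep k).1 (h k hk)).2⟩
  · rintro ⟨h1, h2⟩ k hk
    exact (hstep k).2 ⟨h1 k hk, h2 k hk⟩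

lemma chamber_smul_add_word_iff (w : SignedPerm n) (v : Fin n → ℤ) {N : ℤ} (hN : 2 * n < N) :
    Chamber (N • v + word w) ↔
      ClosedChamber v ∧ ∀ k ∈ descB w, extend v k < extend v (k + 1) := by
  rw [chamber_smul_add_iff v _ (abs_extend_word_le w) hN]
  refine and_congr_right fun _ => ⟨fun h k hk => ?_, fun h k hk hd => ?_⟩
  · have hk' := mem_descB.1 hk
    exact h k hk'.1 (by omega)
  · refine h k ?_
    by_contra hc
    exact hd ((notMem_descB hk).1 hc)

/-- A signed permutation orders the coordinates of all vectors in the open chamber alike. -/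
lemma extend_pull_lt_iff {c : Fin n → ℤ} (hc : Chamber c) (x : SignedPerm n) {k : ℕ} (hk : k < n) :
    extend (pull x c) k < extend (pull x c) (k + 1) ↔
      extend (word x) k < extend (word x) (k + 1) := by
  have key : ∀ c : Fin n → ℤ, Chamber c → (extend (pull x c) k < extend (pull x c) (k + 1) ↔
      if x.left (x.right ⟨k, hk⟩) = 1 then
        ∀ h : 1 ≤ k, x.left (x.right ⟨k - 1, by omega⟩) = 1 →
          x.right ⟨k - 1, by omega⟩ < x.right ⟨k, hk⟩
      else
        ∃ h : 1 ≤ k, x.left (x.right ⟨k - 1, by omega⟩) ≠ 1 ∧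
          x.right ⟨k, hk⟩ < x.right ⟨k - 1, by omega⟩) := by
    intro c hc
    rw [chamber_iff] at hc
    obtain ⟨hpos, hmono⟩ := hc
    have h1 := hpos (x.right ⟨k, hk⟩)
    rw [extend_succ _ hk, pull_apply]
    cases k with
    | zero =>
      rcases Int.units_eq_one_or (x.left (x.right ⟨0, hk⟩)) with h | h
      · simp [h, h1]
      · simp only [extend_zero, h, Units.val_neg, Units.val_one]
        simp
        omega
    | succ k =>
      have hk' : k < n := by omega
      have h2 := hpos (x.right ⟨k, hk'⟩)
      rw [extend_succ _ hk', pull_apply]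
      simp only [Nat.add_sub_cancel]
      simp only [← hmono.lt_iff_lt]
      rcases Int.units_eq_one_or (x.left (x.right ⟨k + 1, hk⟩)) with h | h <;>
      rcases Int.units_eq_one_or (x.left (x.right ⟨k, hk'⟩)) with h' | h' <;>
      simp only [h, h', Units.val_neg, Units.val_one] <;> simp <;> omega
  rw [key c hc, word, key _ chamber_rho]

/-- The vector in the closed chamber which lies off the walls with numbers in `J` only. -/
def jumpVector (n : ℕ) (J : Finset ℕ) : Fin n → ℤ := fun i => (J.filter (· ≤ (i : ℕ))).card

lemma extend_jumpVector (J : Finset ℕ) {k : ℕ} (hk : k < n) :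
    extend (jumpVector n J) (k + 1) =
      extend (jumpVector n J) k + if k ∈ J then 1 else 0 := by
  rw [extend_succ _ hk, jumpVector]
  have h1 : extend (jumpVector n J) k = (J.filter (· < k)).card := by
    cases k with
    | zero => simp
    | succ k => simp [extend_succ _ (show k < n by omega), jumpVector]
  have h2 : J.filter (· ≤ k) = J.filter (· < k) ∪ J.filter (· = k) := by
    rw [← Finset.filter_or]
    exact Finset.filter_congr fun i _ => by omega
  rw [h1, h2, Finset.card_union_of_disjoint, Finset.filter_eq']
  · split_ifs <;> simp
  · rw [Finset.disjoint_filter]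
    intro i _ h
    omega

lemma closedChamber_jumpVector (J : Finset ℕ) : ClosedChamber (jumpVector n J) := by
  intro k hk
  rw [extend_jumpVector J hk]
  split_ifs <;> omega

lemma extend_jumpVector_lt_iff (J : Finset ℕ) {k : ℕ} (hk : k < n) :
    extend (jumpVector n J) k < extend (jumpVector n J) (k + 1) ↔ k ∈ J := by
  rw [extend_jumpVector J hk]
  split_ifs with h <;> simp [h]

/-- Descents of `x` can be read off from the image under `x⁻¹` of any vector in the open chamber. -/
lemma chamber_smul_jumpVector_add_pull_iff {c : Fin n → ℤ} (hc : Chamber c) (x : SignedPerm n)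
    (J : Finset ℕ) {B N : ℤ} (hB0 : 0 ≤ B) (hB : ∀ i, |c i| ≤ B) (hN : 2 * B < N) :
    Chamber (N • jumpVector n J + pull x c) ↔ descB x ⊆ J := by
  have hB' : ∀ k, |extend (pull x c) k| ≤ B := by
    intro k
    unfold extend
    split_ifs with h
    · rw [abs_pull]
      exact hB _
    · simpa using hB0
  rw [chamber_smul_add_iff _ _ hB' hN]
  constructor
  · rintro ⟨-, h⟩ k hk
    have hk' := mem_descB.1 hk
    refine (extend_jumpVector_lt_iff J hk'.1).1 (h k hk'.1 ?_)
    rw [extend_pull_lt_iff hc x hk'.1]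
    omega
  · refine fun h => ⟨closedChamber_jumpVector J, fun k hk hd => ?_⟩
    rw [extend_pull_lt_iff hc x hk, ← notMem_descB hk, not_not] at hd
    exact (extend_jumpVector_lt_iff J hk).2 (h hd)

lemma descB_subset_iff_chamber (w : SignedPerm n) (J : Finset ℕ) {N : ℤ} (hN : 2 * n < N) :
    descB w ⊆ J ↔ Chamber (N • jumpVector n J + word w) := by
  refine (chamber_smul_jumpVector_add_pull_iff chamber_rho w J (by positivity) (fun i => ?_)
    hN).symm
  rw [rho, abs_of_nonneg (by positivity)]
  have := i.2
  omega

/-- Every vector `N h + (1, 2, …, n)` with large `N` is moved into the open chamber by exactly one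
signed permutation: none of its coordinates is zero, and no two are equal up to sign, because this
is so modulo `N`. -/
lemma existsUnique_chamber_smul_add (h : Fin n → ℤ) {N : ℤ} (hN : 2 * n < N) :
    ∃! u : SignedPerm n, Chamber (N • pull u h + word u) := by
  have key : ∀ a b : ℤ, |b| ≤ 2 * n → N * a + b = 0 → b = 0 := by
    intro a b hb hab
    refine Int.eq_zero_of_abs_lt_dvd (m := N) ⟨-a, by linarith⟩ (by omega)
  have hb : ∀ i : Fin n, ((i : ℕ) : ℤ) < n := fun i => by exact_mod_cast i.2
  have := existsUnique_chamber_pull (N • h + rho n) (fun i hi => ?_) (fun i j hij => ?_)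
  · simpa only [pull_add, pull_smul, word] using this
  · have := hb i
    simp only [Pi.add_apply, Pi.smul_apply, smul_eq_mul, rho] at hi
    have := key _ _ (by rw [abs_le]; omega) hi
    omega
  · have h1 := hb i
    have h2 := hb j
    simp only [Pi.add_apply, Pi.smul_apply, smul_eq_mul, rho] at hij
    rcases abs_eq_abs.1 hij with e | e
    · have := key (h i - h j) (i - j) (by rw [abs_le]; omega) (by linarith)
      exact Fin.ext (by omega)
    · have := key (h i + h j) (i + j + 2) (by rw [abs_le]; omega) (by linarith)
      omega

open scoped Classical in
/-- The number of factorizations `w = u u'` with `Des u ⊆ J` and `Des u' ⊆ K` is a number of vectors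
`μ` in the orbit of the vector `λ_J`: the factorization belongs to `μ = w⁻¹ u λ_J`. -/
lemma card_factorizations (J K : Finset ℕ) (w : SignedPerm n) :
    (Finset.univ.filter fun u : SignedPerm n => descB u ⊆ J ∧ descB (u⁻¹ * w) ⊆ K).card =
      ((Finset.univ.image fun x : SignedPerm n => pull x (jumpVector n J)).filter fun μ =>
        Chamber ((2 * n + 1 : ℤ) • ((2 * J.card + 2 : ℤ) • jumpVector n K + μ) + word w)).card := by
  set N : ℤ := 2 * n + 1 with hN
  set lam := jumpVector n J with hlam
  have hN2 : 2 * (n : ℤ) < N := by omega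
  have hlamb : ∀ i, |lam i| ≤ J.card := by
    intro i
    rw [hlam, jumpVector, abs_of_nonneg (by positivity)]
    exact_mod_cast Finset.card_filter_le _ _
  -- Both conditions on `u` are about chambers; the second one involves only `u⁻¹ w lam`.
  have hK : ∀ u : SignedPerm n, descB u ⊆ J → (descB (u⁻¹ * w) ⊆ K ↔
      Chamber (N • ((2 * J.card + 2 : ℤ) • jumpVector n K + pull (u⁻¹ * w) lam) + word w)) := by
    intro u hu
    rw [descB_subset_iff_chamber u J hN2] at hu
    have hb : ∀ i, |(N • lam + word u) i| ≤ N * J.card + n := by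
      intro i
      refine (abs_add_le _ _).trans (add_le_add ?_ ?_)
      · rw [Pi.smul_apply, smul_eq_mul, abs_mul, abs_of_nonneg (by omega)]
        exact mul_le_mul_of_nonneg_left (hlamb i) (by omega)
      · have := abs_extend_word_le u (i + 1)
        rwa [extend_succ _ i.2] at this
    -- The open chamber vector `N lam + word u` serves to test `u⁻¹ w`, in place of `(1, …, n)`.
    rw [← chamber_smul_jumpVector_add_pull_iff hu (u⁻¹ * w) K (by positivity) hb
      (show _ < N * (2 * J.card + 2) by nlinarith), pull_add, pull_smul, ← word_mul,
      mul_inv_cancel_left, smul_add, smul_smul, add_assoc]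
  refine Finset.card_bij (fun u _ => pull (u⁻¹ * w) lam) ?_ ?_ ?_
  · intro u hu
    simp only [Finset.mem_filter, Finset.mem_univ, true_and] at hu
    rw [Finset.mem_filter]
    exact ⟨Finset.mem_image_of_mem _ (Finset.mem_univ _), (hK u hu.1).1 hu.2⟩
  · intro u hu u' hu' e
    simp only [Finset.mem_filter, Finset.mem_univ, true_and] at hu hu'
    rw [pull_mul, pull_mul] at e
    have e' := pull_injective w e
    have h1 := (descB_subset_iff_chamber u J hN2).1 hu.1
    have h2 := (descB_subset_iff_chamber u' J hN2).1 hu'.1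
    refine (existsUnique_chamber_smul_add (pull u⁻¹ lam) hN2).unique ?_ ?_
    · rwa [pull_pull_inv]
    · rwa [e', pull_pull_inv]
  · intro μ hμ
    obtain ⟨hμ1, hμ2⟩ := Finset.mem_filter.1 hμ
    obtain ⟨x, -, rfl⟩ := Finset.mem_image.1 hμ1
    obtain ⟨u, hu, -⟩ := existsUnique_chamber_smul_add (pull w⁻¹ (pull x lam)) hN2
    have hl : pull u (pull w⁻¹ (pull x lam)) = lam := by
      have h1 := ((chamber_smul_add_word_iff u _ hN2).1 hu).1
      rw [← pull_mul, ← pull_mul] at h1 ⊢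
      exact pull_eq_self_of_closedChamber (closedChamber_jumpVector J) h1
    have hx : pull (u⁻¹ * w) lam = pull x lam := by
      conv_lhs => rw [← hl]
      rw [← pull_mul, ← pull_mul, ← pull_mul]
      congr 1
      group
    rw [hl, ← descB_subset_iff_chamber u J hN2] at hu
    refine ⟨u, ?_, hx⟩
    simp only [Finset.mem_filter, Finset.mem_univ, true_and]
    refine ⟨hu, (hK u hu).2 ?_⟩
    rwa [hx]

/-- The chamber condition in `card_factorizations` sees `w` only through its descents. -/
lemma card_factorizations_congr (J K : Finset ℕ) {w w' : SignedPerm n} (h : descB w = descB w') :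
    (Finset.univ.filter fun u : SignedPerm n => descB u ⊆ J ∧ descB (u⁻¹ * w) ⊆ K).card =
      (Finset.univ.filter fun u : SignedPerm n => descB u ⊆ J ∧ descB (u⁻¹ * w') ⊆ K).card := by
  classical
  rw [card_factorizations, card_factorizations]
  simp only [chamber_smul_add_word_iff _ _ (lt_add_one (2 * (n : ℤ))), h]

/-- The sums over `Des w ⊆ J` span the descent algebra as well as those over `Des w = J`. -/
lemma fiberConst_descB_eq_span :
    fiberConst (descB (n := n)) =
      Submodule.span ℚ (Set.range fun J : Finset ℕ => setSum {w : SignedPerm n | descB w ⊆ J}) := by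
  apply le_antisymm
  · rw [← span_setSum_fiber (descB (n := n)) (fun _ => True) (fun _ => trivial), Submodule.span_le]
    rintro _ ⟨J, -, rfl⟩
    induction J using Finset.strongInduction with
    | H J ih =>
      have e : setSum {w : SignedPerm n | descB w = J} = setSum {w : SignedPerm n | descB w ⊆ J} -
          ∑ I ∈ J.ssubsets, setSum {w : SignedPerm n | descB w = I} := by
        ext w
        simp only [MonoidAlgebra.coeff_sub, MonoidAlgebra.coeff_sum, Finsupp.sub_apply,
          Finsupp.finsetSum_apply, coeff_setSum_filter, Finset.sum_ite_eq, Finset.mem_ssubsets]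
        by_cases h1 : descB w = J
        · simp [h1]
        · simp [h1, Finset.ssubset_iff_subset_ne]
      rw [e]
      refine Submodule.sub_mem _ (Submodule.subset_span ⟨J, rfl⟩)
        (Submodule.sum_mem _ fun I hI => ?_)
      exact ih I (Finset.mem_ssubsets.1 hI)
  · rw [Submodule.span_le]
    rintro _ ⟨J, rfl⟩ w w' h
    simp [coeff_setSum_filter, h]

lemma fiberConst_descB_mul_mem {a b : MonoidAlgebra ℚ (SignedPerm n)}
    (ha : a ∈ fiberConst (descB (n := n))) (hb : b ∈ fiberConst (descB (n := n))) :
    a * b ∈ fiberConst (descB (n := n)) := by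
  have h : fiberConst (descB (n := n)) * fiberConst descB ≤ fiberConst descB := by
    conv_lhs => rw [fiberConst_descB_eq_span, Submodule.span_mul_span]
    rw [Submodule.span_le]
    rintro _ ⟨_, ⟨J, rfl⟩, _, ⟨K, rfl⟩, rfl⟩ w w' h
    simp only [coeff_setSum_mul, card_factorizations_congr J K h]
  exact h (Submodule.mul_mem_mul ha hb)

lemma one_mem_fiberConst_descB : (1 : MonoidAlgebra ℚ (SignedPerm n)) ∈ fiberConst descB := by
  intro w w' h
  have : w = 1 ↔ w' = 1 := by rw [← descB_eq_empty_iff, h, descB_eq_empty_iff]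
  simp only [MonoidAlgebra.one_def, MonoidAlgebra.coeff_single, Finsupp.single_apply, eq_comm,
    this]

end Solomon

/-! ### Descent sets of the Coxeter generators in types `A`, `B` and `D` -/

section Generators

variable {n : ℕ}

/-- Contribution of a pair of letters to the length of a signed permutation in type `D`. -/
def pairCost (x y : ℤ) : ℕ := (if y < x then 1 else 0) + if x + y < 0 then 1 else 0

lemma pairCost_neg_left (x y : ℤ) : pairCost (-x) y = pairCost x y := by
  unfold pairCost
  rw [add_comm]
  congr 1 <;> exact if_congr (by omega) rfl rfl

lemma pairCost_swap {x y : ℤ} (h : x < y) : pairCost y x = pairCost x y + 1 := by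
  unfold pairCost
  rw [if_pos h, if_neg (not_lt.2 h.le), add_comm y x]
  omega

/-- The number of pairs of positions `i < j` with `w_i > w_j`, plus the number of those with
`w_i + w_j < 0`. -/
def pairStat (u : Fin n → ℤ) : ℕ :=
  ∑ p : Fin n × Fin n with p.1 < p.2, pairCost (u p.1) (u p.2)

/-- Exchanging adjacent letters affects the contribution of no other pair of letters. -/
lemma pairStat_comp_swap {u : Fin n → ℤ} {i j : Fin n} (hij : (i : ℕ) + 1 = j) (h : u i < u j) :
    pairStat (u ∘ Equiv.swap i j) = pairStat u + 1 := by
  have hlt : i < j := by rw [Fin.lt_def]; omega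
  set L : Finset (Fin n × Fin n) := {p | p.1 < p.2} with hL
  have hmem : (i, j) ∈ L := by simp [hL, hlt]
  have hnot : (j, i) ∉ L.erase (i, j) := by simp [hL, hlt.le]
  have key : pairStat (u ∘ Equiv.swap i j) =
      ∑ p ∈ insert (j, i) (L.erase (i, j)), pairCost (u p.1) (u p.2) := by
    refine Finset.sum_equiv ((Equiv.swap i j).prodCongr (Equiv.swap i j)) ?_ ?_
    · rintro ⟨a, b⟩
      simp only [Finset.mem_filter, Finset.mem_univ, true_and, Equiv.prodCongr_apply,
        Prod.map_apply,
        Finset.mem_insert, Finset.mem_erase, hL, Prod.mk.injEq, ne_eq]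
      simp only [Equiv.swap_apply_def, Fin.ext_iff, Fin.lt_def]
      split_ifs <;> simp <;> omega
    · rintro ⟨a, b⟩ _
      rfl
  rw [key, Finset.sum_insert hnot, pairCost_swap h, pairStat, ← hL,
    ← Finset.add_sum_erase L _ hmem]
  simp only
  omega

/-- The sign of the first letter is irrelevant for `pairStat`, since negating it exchanges the two
conditions. -/
lemma pairStat_neg_first {u v : Fin n → ℤ} {i : Fin n} (hi : (i : ℕ) = 0) (h0 : v i = -u i)
    (h : ∀ j ≠ i, v j = u j) : pairStat v = pairStat u := by
  refine Finset.sum_congr rfl fun p hp => ?_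
  have hp' : p.1 < p.2 := by simpa using hp
  have h2 : v p.2 = u p.2 := by
    refine h _ fun e => ?_
    rw [e, Fin.lt_def] at hp'
    omega
  rw [h2]
  by_cases h1 : p.1 = i
  · rw [h1, h0, pairCost_neg_left]
  · rw [h _ h1]

lemma pairStat_rho : pairStat (rho n) = 0 := by
  refine Finset.sum_eq_zero fun p hp => ?_
  have hp' : p.1 < p.2 := by simpa using hp
  rw [Fin.lt_def] at hp'
  unfold pairCost
  rw [if_neg (by simp only [rho]; omega), if_neg (by simp only [rho]; omega), add_zero]

lemma word_mul_inr (w : SignedPerm n) (s : Equiv.Perm (Fin n)) :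
    word (w * SemidirectProduct.inr s) = word w ∘ s := by
  rw [word_mul]
  ext i
  simp [pull]

lemma word_mul_inl (w : SignedPerm n) (e : Fin n → ℤˣ) (i : Fin n) :
    word (w * SemidirectProduct.inl e) i = e i * word w i := by
  rw [word_mul]
  simp [pull]

/-- The transposition `(k, k+1)` if `1 ≤ k < n`. -/
def genA (n k : ℕ) : Equiv.Perm (Fin n) :=
  if h : 1 ≤ k ∧ k < n then Equiv.swap ⟨k - 1, by omega⟩ ⟨k, h.2⟩ else 1

lemma genA_succ {k : ℕ} (h : k + 1 < n) :
    genA n (k + 1) = Equiv.swap ⟨k, by omega⟩ ⟨k + 1, h⟩ := by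
  simp [genA, h]

lemma genA_mul_self (k : ℕ) : genA n k * genA n k = 1 := by
  unfold genA
  split_ifs <;> simp

lemma generatorsA_eq_image : generatorsA n = genA n '' Set.Ico 1 n := by
  ext s
  simp only [generatorsA, Set.mem_ofPred_eq, Set.mem_image, Set.mem_Ico]
  constructor
  · rintro ⟨i, j, hij, rfl⟩
    refine ⟨i + 1, by omega, ?_⟩
    rw [genA_succ (by omega)]
    congr 1
    exact Fin.ext hij
  · rintro ⟨k, ⟨h1, h2⟩, rfl⟩
    obtain ⟨k, rfl⟩ := Nat.exists_eq_add_of_le' h1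
    exact ⟨⟨k, by omega⟩, ⟨k + 1, h2⟩, rfl, genA_succ h2⟩

lemma extend_comp_genA (u : Fin n → ℤ) {k : ℕ} (h : k ∈ Set.Ico 1 n) :
    extend (u ∘ genA n k) k = extend u (k + 1) ∧ extend (u ∘ genA n k) (k + 1) = extend u k := by
  obtain ⟨h1, h2⟩ := h
  obtain ⟨k, rfl⟩ := Nat.exists_eq_add_of_le' h1
  rw [extend_succ _ h2, extend_succ _ h2, extend_succ _ (show k < n by omega),
    extend_succ _ (show k < n by omega), genA_succ h2]
  simp

lemma pairStat_comp_genA {u : Fin n → ℤ} {k : ℕ} (h : k ∈ Set.Ico 1 n)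
    (hu : extend u k < extend u (k + 1)) : pairStat (u ∘ genA n k) = pairStat u + 1 := by
  obtain ⟨h1, h2⟩ := h
  obtain ⟨k, rfl⟩ := Nat.exists_eq_add_of_le' h1
  rw [extend_succ _ h2, extend_succ _ (show k < n by omega)] at hu
  rw [genA_succ h2]
  exact pairStat_comp_swap rfl hu

lemma mem_descB_mul_genA (w : SignedPerm n) {k : ℕ} (h : k ∈ Set.Ico 1 n) :
    k ∈ descB (w * SemidirectProduct.inr (genA n k)) ↔ k ∉ descB w := by
  rw [notMem_descB h.2, mem_descB, word_mul_inr, (extend_comp_genA _ h).1,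
    (extend_comp_genA _ h).2, and_iff_right h.2]

lemma descB_inr_subset (σ : Equiv.Perm (Fin n)) {k : ℕ}
    (hk : k ∈ descB (SemidirectProduct.inr σ : SignedPerm n)) : k ∈ Set.Ico 1 n := by
  rw [mem_descB] at hk
  refine ⟨?_, hk.1⟩
  by_contra hc
  obtain rfl : k = 0 := by omega
  obtain ⟨hn, hlt⟩ := hk
  rw [extend_succ _ hn, word_apply, extend_zero] at hlt
  simp at hlt
  omega

lemma Des_generatorsA_eq_iff (σ τ : Equiv.Perm (Fin n)) :
    Des (generatorsA n) σ = Des (generatorsA n) τ ↔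
      descB (SemidirectProduct.inr σ : SignedPerm n) = descB (SemidirectProduct.inr τ) := by
  rw [generatorsA_eq_image]
  refine Des_eq_Des_iff (D := fun σ => descB (SemidirectProduct.inr σ : SignedPerm n))
    (fun σ k hk => ?_) (fun σ k hk => descB_inr_subset σ hk) σ τ
  refine mem_Des_iff_of_statistic (genA n) (Set.Ico 1 n)
    (fun σ => pairStat (word (SemidirectProduct.inr σ : SignedPerm n)))
    (fun σ => descB (SemidirectProduct.inr σ : SignedPerm n))
    (fun k _ => genA_mul_self k) ?_ ?_ ?_ ?_ σ k hk
  · simp [word, pairStat_rho]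
  · intro σ k hk
    simp only [map_mul]
    exact mem_descB_mul_genA _ hk
  · intro σ k hk hd
    simp only [map_mul, word_mul_inr]
    exact pairStat_comp_genA hk ((notMem_descB hk.2).1 hd)
  · intro σ h
    have : descB (SemidirectProduct.inr σ : SignedPerm n) = ∅ :=
      Finset.eq_empty_of_forall_notMem fun k hk => h k (descB_inr_subset σ hk) hk
    rw [descB_eq_empty_iff] at this
    exact SemidirectProduct.inr_injective (this.trans (map_one _).symm)

/-- The signed permutation `s_0` if `k = 0 < n`, and `(k, k+1)` if `1 ≤ k < n`. -/
def genB (n k : ℕ) : SignedPerm n :=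
  if h : k = 0 ∧ 0 < n then SemidirectProduct.inl (Pi.mulSingle ⟨0, h.2⟩ (-1))
  else SemidirectProduct.inr (genA n k)

lemma genB_zero (h : 0 < n) :
    genB n 0 = SemidirectProduct.inl (Pi.mulSingle ⟨0, h⟩ (-1)) := by
  simp [genB, h]

lemma genB_of_ne_zero {k : ℕ} (h : k ≠ 0) : genB n k = SemidirectProduct.inr (genA n k) := by
  simp [genB, h]

lemma genB_mul_self (k : ℕ) : genB n k * genB n k = 1 := by
  unfold genB
  split_ifs
  · rw [← map_mul, ← Pi.mulSingle_mul]
    simp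
  · rw [← map_mul, genA_mul_self, map_one]

lemma generatorsB_eq_image : generatorsB n = genB n '' Set.Iio n := by
  ext s
  simp only [generatorsB, Set.mem_union, Set.mem_ofPred_eq, Set.mem_image, Set.mem_Iio,
    generatorsA_eq_image]
  constructor
  · rintro (⟨_, ⟨k, hk, rfl⟩, rfl⟩ | ⟨i, hi, rfl⟩)
    · exact ⟨k, hk.2, genB_of_ne_zero (by have := hk.1; omega)⟩
    · refine ⟨0, by omega, ?_⟩
      rw [genB_zero (by omega)]
      rw [show (⟨0, _⟩ : Fin n) = i from Fin.ext hi.symm]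
  · rintro ⟨k, hk, rfl⟩
    rcases Nat.eq_zero_or_pos k with rfl | h
    · exact Or.inr ⟨⟨0, hk⟩, rfl, genB_zero hk⟩
    · exact Or.inl ⟨_, ⟨k, ⟨h, hk⟩, rfl⟩, genB_of_ne_zero h.ne'⟩

lemma word_mul_genB_zero (w : SignedPerm n) {i : Fin n} (hi : (i : ℕ) = 0) :
    word (w * genB n 0) i = - word w i ∧ ∀ j ≠ i, word (w * genB n 0) j = word w j := by
  have hn : 0 < n := by omega
  obtain rfl : i = ⟨0, hn⟩ := Fin.ext hi
  rw [genB_zero hn]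
  refine ⟨by simp [word_mul_inl], fun j hj => ?_⟩
  rw [word_mul_inl, Pi.mulSingle_eq_of_ne hj]
  simp

lemma mem_descB_mul_genB_zero (w : SignedPerm n) (hn : 0 < n) :
    0 ∈ descB (w * genB n 0) ↔ 0 ∉ descB w := by
  rw [notMem_descB hn, mem_descB, extend_succ _ hn, extend_succ _ hn,
    (word_mul_genB_zero w (i := ⟨0, hn⟩) rfl).1]
  simp [hn]

lemma Des_generatorsB_eq_iff (w w' : SignedPerm n) :
    Des (generatorsB n) w = Des (generatorsB n) w' ↔ descB w = descB w' := by
  rw [generatorsB_eq_image]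
  refine Des_eq_Des_iff (D := descB (n := n)) (K := Set.Iio n) (fun w k hk => ?_)
    (fun w k hk => (mem_descB.1 hk).1) w w'
  refine mem_Des_iff_of_statistic (genB n) (Set.Iio n)
    (fun w => pairStat (word w) + ∑ i, if word w i < 0 then 1 else 0) descB
    (fun k _ => genB_mul_self k) ?_ ?_ ?_ ?_ w k hk
  · have h : ∀ i : Fin n, ¬ rho n i < 0 := fun i => by simp only [rho]; omega
    simp [word, pairStat_rho, h]
  · intro w k hk
    rcases Nat.eq_zero_or_pos k with rfl | h
    · exact mem_descB_mul_genB_zero w hk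
    · rw [genB_of_ne_zero h.ne']
      exact mem_descB_mul_genA w ⟨h, hk⟩
  · intro w k hk hd
    rw [notMem_descB hk] at hd
    rcases Nat.eq_zero_or_pos k with rfl | h
    · have hk0 : 0 < n := hk
      obtain ⟨h1, h2⟩ := word_mul_genB_zero w (i := ⟨0, hk0⟩) rfl
      rw [extend_zero, extend_succ _ hk0] at hd
      simp only [pairStat_neg_first rfl h1 h2]
      rw [← Finset.add_sum_erase _ _ (Finset.mem_univ (⟨0, hk0⟩ : Fin n)),
        ← Finset.add_sum_erase _ _ (Finset.mem_univ (⟨0, hk0⟩ : Fin n)), h1,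
        if_pos (by omega), if_neg (by omega)]
      rw [Finset.sum_congr rfl fun j hj => by rw [h2 j (Finset.ne_of_mem_erase hj)]]
      omega
    · simp only [genB_of_ne_zero h.ne', word_mul_inr, Function.comp_apply]
      rw [pairStat_comp_genA ⟨h, hk⟩ hd,
        Equiv.sum_comp (genA n k) fun i => if word w i < 0 then 1 else 0]
      omega
  · intro w h
    rw [← descB_eq_empty_iff]
    exact Finset.eq_empty_of_forall_notMem fun k hk => h k (mem_descB.1 hk).1 hk

/-- The descents of a signed permutation in type `D`, if `n ≥ 2`: those in type `B`, except that
`0` stands for the generator `s_{1'}` and is a descent if and only if `w_1 + w_2 < 0`. -/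
def descD (w : SignedPerm n) : Finset ℕ :=
  {k ∈ Finset.range n | if k = 0 then extend (word w) 1 + extend (word w) 2 < 0 else k ∈ descB w}

lemma mem_descD_of_ne_zero {w : SignedPerm n} {k : ℕ} (hk : k ≠ 0) :
    k ∈ descD w ↔ k ∈ descB w := by
  simp only [descD, Finset.mem_filter, hk, if_false, Finset.mem_range, and_iff_right_iff_imp]
  exact fun h => (mem_descB.1 h).1

lemma zero_mem_descD {w : SignedPerm n} (hn : 0 < n) :
    0 ∈ descD w ↔ extend (word w) 1 + extend (word w) 2 < 0 := by
  simp [descD, hn]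

lemma extend_word_mul_genB_zero (w : SignedPerm n) (hn : 2 ≤ n) :
    extend (word (w * genB n 0)) 1 = - extend (word w) 1 ∧
      ∀ k ≠ 1, extend (word (w * genB n 0)) k = extend (word w) k := by
  obtain ⟨h1, h2⟩ := word_mul_genB_zero w (i := ⟨0, by omega⟩) rfl
  refine ⟨?_, ?_⟩
  · rw [extend_succ _ (show 0 < n by omega), extend_succ _ (show 0 < n by omega), h1]
  · intro k hk
    unfold extend
    split_ifs with h
    · exact h2 _ fun e => hk (by have := congrArg Fin.val e; simp at this; omega)
    · rfl

/-- `s_{1'} = s_0 s_1 s_0` turns descents at `0` in type `D` into descents at `1` in type `B`. -/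
lemma zero_mem_descD_iff (w : SignedPerm n) (hn : 2 ≤ n) :
    0 ∈ descD w ↔ 1 ∈ descB (w * genB n 0) := by
  obtain ⟨h1, h2⟩ := extend_word_mul_genB_zero w hn
  rw [zero_mem_descD (by omega), mem_descB, h1, h2 (1 + 1) (by norm_num)]
  norm_num
  omega

/-- The generator `s_{1'}` is `s_0 s_1 s_0`. -/
lemma genB_conj (hn : 2 ≤ n) : genB n 0 * genB n 1 * genB n 0 =
    ⟨Pi.mulSingle ⟨0, by omega⟩ (-1) * Pi.mulSingle ⟨1, by omega⟩ (-1),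
      Equiv.swap ⟨0, by omega⟩ ⟨1, by omega⟩⟩ := by
  rw [genB_zero (by omega), genB_of_ne_zero one_ne_zero,
    show genA n 1 = _ from genA_succ (k := 0) (by omega)]
  refine SemidirectProduct.ext ?_ (by simp)
  simp only [SemidirectProduct.mul_left, SemidirectProduct.left_inl, SemidirectProduct.left_inr,
    SemidirectProduct.mul_right, SemidirectProduct.right_inl, SemidirectProduct.right_inr, map_one,
    one_mul, mul_one]
  congr 1
  ext i
  change ((Pi.mulSingle (⟨0, _⟩ : Fin n) (-1) : Fin n → ℤˣ)
    ((Equiv.swap (⟨0, _⟩ : Fin n) ⟨0 + 1, _⟩)⁻¹ • i) : ℤ) = _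
  rw [Equiv.swap_inv, Equiv.Perm.smul_def, Pi.mulSingle_apply, Pi.mulSingle_apply]
  simp only [Equiv.swap_apply_eq_iff, Equiv.swap_apply_left]

/-- The generator `s_{1'}` if `k = 0` and `2 ≤ n`, and `(k, k+1)` if `1 ≤ k < n`. -/
def genD (n k : ℕ) : evenSignedPerm n :=
  if h : k = 0 ∧ 2 ≤ n then
    ⟨⟨Pi.mulSingle ⟨0, by omega⟩ (-1) * Pi.mulSingle ⟨1, by omega⟩ (-1),
      Equiv.swap ⟨0, by omega⟩ ⟨1, by omega⟩⟩, by
        change ∏ i, _ = (1 : ℤˣ)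
        simp [Finset.prod_mul_distrib]⟩
  else ⟨SemidirectProduct.inr (genA n k), by change ∏ i, _ = (1 : ℤˣ); simp⟩

lemma coe_genD_zero (hn : 2 ≤ n) :
    (genD n 0 : SignedPerm n) = genB n 0 * genB n 1 * genB n 0 := by
  rw [genB_conj hn]
  simp [genD, hn]

lemma coe_genD_of_ne_zero {k : ℕ} (h : k ≠ 0) :
    (genD n k : SignedPerm n) = SemidirectProduct.inr (genA n k) := by
  simp [genD, h]

lemma generatorsD_eq_image (hn : 2 ≤ n) : generatorsD n = genD n '' Set.Iio n := by
  ext s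
  simp only [generatorsD, Set.mem_union, Set.mem_ofPred_eq, Set.mem_image, Set.mem_Iio,
    generatorsA_eq_image]
  constructor
  · rintro (⟨_, ⟨k, hk, rfl⟩, hs⟩ | ⟨i, j, hi, hj, hs⟩)
    · refine ⟨k, hk.2, Subtype.ext ?_⟩
      rw [hs, coe_genD_of_ne_zero (by have := hk.1; omega)]
    · refine ⟨0, by omega, Subtype.ext ?_⟩
      have hi' : i = ⟨0, by omega⟩ := Fin.ext hi
      have hj' : j = ⟨1, by omega⟩ := Fin.ext hj
      rw [hs, hi', hj', coe_genD_zero hn, genB_conj hn]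
  · rintro ⟨k, hk, rfl⟩
    rcases Nat.eq_zero_or_pos k with rfl | h
    · refine Or.inr ⟨⟨0, hk⟩, ⟨1, by omega⟩, rfl, rfl, ?_⟩
      rw [coe_genD_zero hn, genB_conj hn]
    · exact Or.inl ⟨_, ⟨k, ⟨h, hk⟩, rfl⟩, coe_genD_of_ne_zero h.ne'⟩

lemma genB_zero_notMem_evenSignedPerm (hn : 0 < n) : genB n 0 ∉ evenSignedPerm n := by
  rw [genB_zero hn]
  intro h
  have h' : ∏ i, (Pi.mulSingle (⟨0, hn⟩ : Fin n) (-1) : Fin n → ℤˣ) i = 1 := h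
  simp at h'

lemma pairStat_word_mul_genB_zero (w : SignedPerm n) :
    pairStat (word (w * genB n 0)) = pairStat (word w) := by
  rcases Nat.eq_zero_or_pos n with rfl | hn
  · exact congrArg pairStat (funext fun i => i.elim0)
  · obtain ⟨h1, h2⟩ := word_mul_genB_zero w (i := ⟨0, hn⟩) rfl
    exact pairStat_neg_first rfl h1 h2

lemma Des_generatorsD_eq_iff (hn : 2 ≤ n) (w w' : evenSignedPerm n) :
    Des (generatorsD n) w = Des (generatorsD n) w' ↔
      descD (w : SignedPerm n) = descD (w' : SignedPerm n) := by
  rw [generatorsD_eq_image hn]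
  refine Des_eq_Des_iff (D := fun w : evenSignedPerm n => descD (w : SignedPerm n))
    (fun w k hk => ?_) (fun w k hk => by simpa using (Finset.mem_filter.1 hk).1) w w'
  have hone : (1 : ℕ) ∈ Set.Ico 1 n := ⟨le_rfl, hn⟩
  refine mem_Des_iff_of_statistic (genD n) (Set.Iio n)
    (fun w => pairStat (word (w : SignedPerm n))) (fun w => descD (w : SignedPerm n))
    ?_ ?_ ?_ ?_ ?_ w k hk
  · intro k _
    refine Subtype.ext ?_
    rw [Subgroup.coe_mul, Subgroup.coe_one]
    rcases Nat.eq_zero_or_pos k with rfl | h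
    · rw [coe_genD_zero hn]
      simp only [mul_assoc]
      rw [← mul_assoc (genB n 0) (genB n 0), genB_mul_self, one_mul,
        ← mul_assoc (genB n 1) (genB n 1), genB_mul_self, one_mul, genB_mul_self]
    · rw [coe_genD_of_ne_zero h.ne', ← map_mul, genA_mul_self, map_one]
  · simp [word, pairStat_rho]
  · intro w k hk
    simp only [Subgroup.coe_mul]
    rcases Nat.eq_zero_or_pos k with rfl | h
    · rw [zero_mem_descD_iff _ hn, zero_mem_descD_iff _ hn, coe_genD_zero hn, ← mul_assoc,
        mul_assoc _ (genB n 0) (genB n 0), genB_mul_self, mul_one, ← mul_assoc,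
        genB_of_ne_zero one_ne_zero]
      exact mem_descB_mul_genA _ hone
    · rw [coe_genD_of_ne_zero h.ne', mem_descD_of_ne_zero h.ne', mem_descD_of_ne_zero h.ne']
      exact mem_descB_mul_genA _ ⟨h, hk⟩
  · intro w k hk hd
    simp only [Subgroup.coe_mul]
    rcases Nat.eq_zero_or_pos k with rfl | h
    · rw [zero_mem_descD_iff _ hn, notMem_descB hone.2] at hd
      rw [coe_genD_zero hn, ← mul_assoc, pairStat_word_mul_genB_zero, ← mul_assoc,
        genB_of_ne_zero one_ne_zero, word_mul_inr, pairStat_comp_genA hone hd,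
        pairStat_word_mul_genB_zero]
    · rw [mem_descD_of_ne_zero h.ne', notMem_descB hk] at hd
      rw [coe_genD_of_ne_zero h.ne', word_mul_inr]
      exact pairStat_comp_genA ⟨h, hk⟩ hd
  · intro w h
    have hB : ∀ w : SignedPerm n, 0 < extend (word w) 1 →
        (∀ k, 1 ≤ k → k < n → extend (word w) k < extend (word w) (k + 1)) → w = 1 := by
      intro w h0 h1
      refine eq_one_of_chamber_word fun k hk => ?_
      rcases Nat.eq_zero_or_pos k with rfl | hk0
      · simpa using h0
      · exact h1 k hk0 hk
    have h1 : ∀ k, 1 ≤ k → k < n →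
        extend (word (w : SignedPerm n)) k < extend (word (w : SignedPerm n)) (k + 1) := by
      intro k hk0 hk
      have := h k hk
      rwa [mem_descD_of_ne_zero (by omega), notMem_descB hk] at this
    have h0 := h 0 (show 0 < n by omega)
    rw [zero_mem_descD_iff _ hn, notMem_descB hone.2] at h0
    obtain ⟨e1, e2⟩ := extend_word_mul_genB_zero (w : SignedPerm n) hn
    rcases lt_or_ge 0 (extend (word (w : SignedPerm n)) 1) with hpos | hneg
    · exact Subtype.ext (hB _ hpos h1)
    -- If the first letter were negative, then `w` would be `s_0`, which is not even.
    · exfalso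
      have hne := extend_word_ne (w : SignedPerm n) (show 0 < n by omega)
      rw [extend_zero, zero_add] at hne
      have hw : (w : SignedPerm n) * genB n 0 = 1 := by
        refine hB _ (by omega) fun k hk0 hk => ?_
        rcases hk0.eq_or_lt with rfl | hk1
        · exact h0
        · rw [e2 k (by omega), e2 (k + 1) (by omega)]
          exact h1 k hk0 hk
      refine genB_zero_notMem_evenSignedPerm (n := n) (by omega) ?_
      rw [eq_inv_of_mul_eq_one_right hw]
      exact inv_mem w.2

end Generators

/-! ### Signings of a permutation with given descents in type `B` -/

section Signings

variable {n : ℕ}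

/-- The descents of a permutation, as a set of positions. -/
def descA (σ : Equiv.Perm (Fin n)) : Finset ℕ := descB (SemidirectProduct.inr σ : SignedPerm n)

lemma extend_word_inr (σ : Equiv.Perm (Fin n)) (k : ℕ) :
    extend (word (SemidirectProduct.inr σ : SignedPerm n)) k = letter σ k := by
  unfold extend letter
  split_ifs
  · rw [word_apply]
    simp
  · simp

lemma mem_descA {σ : Equiv.Perm (Fin n)} {k : ℕ} :
    k ∈ descA σ ↔ k < n ∧ letter σ (k + 1) < letter σ k := by
  rw [descA, mem_descB, extend_word_inr, extend_word_inr, Nat.cast_lt]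

lemma notMem_descA {σ : Equiv.Perm (Fin n)} {k : ℕ} (h : k < n) :
    k ∉ descA σ ↔ letter σ k < letter σ (k + 1) := by
  rw [descA, notMem_descB h, extend_word_inr, extend_word_inr, Nat.cast_lt]

lemma one_le_of_mem_descA {σ : Equiv.Perm (Fin n)} {k : ℕ} (h : k ∈ descA σ) : 1 ≤ k :=
  (descB_inr_subset σ h).1

lemma succ_mem_Peak {σ : Equiv.Perm (Fin n)} {k : ℕ} :
    k + 1 ∈ Peak σ ↔ k ∉ descA σ ∧ k + 1 ∈ descA σ := by
  rw [Peak, Finset.mem_filter, Finset.mem_Icc, mem_descA (k := k + 1), Nat.add_sub_cancel]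
  constructor
  · rintro ⟨h1, h2, h3⟩
    exact ⟨(notMem_descA (by omega)).2 h2, by omega, h3⟩
  · rintro ⟨h1, h2, h3⟩
    exact ⟨by omega, (notMem_descA (by omega)).1 h1, h3⟩

lemma zero_notMem_Peak (σ : Equiv.Perm (Fin n)) : 0 ∉ Peak σ := by
  simp [Peak]

lemma one_mem_Peak_iff {σ : Equiv.Perm (Fin n)} : 1 ∈ Peak σ ↔ 1 ∈ descA σ := by
  rw [← zero_add 1, succ_mem_Peak, and_iff_right]
  exact fun h => by simpa using one_le_of_mem_descA h

lemma Peak_eq_map_filter (σ : Equiv.Perm (Fin n)) :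
    Peak σ = ((Finset.range n).filter fun k => k ∉ descA σ ∧ k + 1 ∈ descA σ).map
      (addRightEmbedding 1) := by
  ext i
  cases i with
  | zero => simp [zero_notMem_Peak]
  | succ k =>
    rw [succ_mem_Peak]
    simp only [Finset.mem_map, Finset.mem_filter, Finset.mem_range, addRightEmbedding_apply,
      add_left_inj, exists_eq_right, iff_and_self]
    rintro ⟨-, h⟩
    have := (mem_descA.1 h).1
    omega

/-- Peaks and valleys alternate: between the initial ascent `0 < w_1` and the end of the word there
are as many positions where descents stop as positions where they start. -/
lemma card_valleys (σ : Equiv.Perm (Fin n)) :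
    ((Finset.range n).filter fun k => k ∈ descA σ ∧ k + 1 ∉ descA σ).card = (Peak σ).card := by
  rw [Peak_eq_map_filter, Finset.card_map]
  have h := Finset.sum_range_sub (fun k => if k ∈ descA σ then (1 : ℤ) else 0) n
  have h0 : 0 ∉ descA σ := fun h => by simpa using one_le_of_mem_descA h
  have hn : n ∉ descA σ := fun h => lt_irrefl _ (mem_descA.1 h).1
  rw [if_neg h0, if_neg hn] at h
  have : ∀ k, ((if k + 1 ∈ descA σ then (1 : ℤ) else 0) - if k ∈ descA σ then 1 else 0) =
      (if k ∉ descA σ ∧ k + 1 ∈ descA σ then 1 else 0) -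
        if k ∈ descA σ ∧ k + 1 ∉ descA σ then 1 else 0 := by
    intro k
    by_cases h1 : k ∈ descA σ <;> by_cases h2 : k + 1 ∈ descA σ <;> simp [h1, h2]
  simp only [this, Finset.sum_sub_distrib, ← Finset.sum_filter, Finset.sum_const, nsmul_eq_mul,
    mul_one] at h
  omega

lemma word_mk (ε : Fin n → ℤˣ) (σ : Equiv.Perm (Fin n)) {k : ℕ} (h : k < n) :
    extend (word (⟨ε, σ⟩ : SignedPerm n)) (k + 1) = ε (σ ⟨k, h⟩) * (letter σ (k + 1) : ℤ) := by
  rw [extend_succ _ h, word_apply, letter, dif_pos (by omega)]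
  simp

/-- At a descent of the underlying permutation, the larger letter, whose sign decides whether there
is a descent, is the left one. -/
lemma mem_descB_mk_of_mem {ε : Fin n → ℤˣ} {σ : Equiv.Perm (Fin n)} {k : ℕ}
    (h : k + 1 ∈ descA σ) (hk : k < n) :
    k + 1 ∈ descB (⟨ε, σ⟩ : SignedPerm n) ↔ ε (σ ⟨k, hk⟩) = 1 := by
  have hk' := mem_descA.1 h
  rw [mem_descB, word_mk _ _ hk, word_mk _ _ hk'.1]
  rcases Int.units_eq_one_or (ε (σ ⟨k, hk⟩)) with h1 | h1 <;>
  rcases Int.units_eq_one_or (ε (σ ⟨k + 1, hk'.1⟩)) with h2 | h2 <;>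
  rw [h1, h2] <;> simp <;> omega

/-- At an ascent of the underlying permutation, the sign of the right letter decides whether there
is a descent. -/
lemma mem_descB_mk_of_notMem {ε : Fin n → ℤˣ} {σ : Equiv.Perm (Fin n)} {k : ℕ}
    (h : k ∉ descA σ) (hk : k < n) :
    k ∈ descB (⟨ε, σ⟩ : SignedPerm n) ↔ ε (σ ⟨k, hk⟩) = -1 := by
  have hlt := (notMem_descA hk).1 h
  rw [mem_descB, word_mk _ _ hk, and_iff_right hk]
  cases k with
  | zero =>
    rcases Int.units_eq_one_or (ε (σ ⟨0, hk⟩)) with h1 | h1 <;> rw [h1] <;> simp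
    simpa [letter] using hlt
  | succ k =>
    rw [word_mk _ _ (show k < n by omega)]
    rcases Int.units_eq_one_or (ε (σ ⟨k, by omega⟩)) with h1 | h1 <;>
    rcases Int.units_eq_one_or (ε (σ ⟨k + 1, hk⟩)) with h2 | h2 <;>
    rw [h1, h2] <;> simp <;> omega

/-- The signs of the letter at position `p + 1` which are compatible with the descent set `J`. -/
def allowedSigns (σ : Equiv.Perm (Fin n)) (J : Finset ℕ) (p : ℕ) : Finset ℤˣ :=
  {e | (p ∉ descA σ → (p ∈ J ↔ e = -1)) ∧ (p + 1 ∈ descA σ → (p + 1 ∈ J ↔ e = 1))}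

lemma card_allowedSigns (σ : Equiv.Perm (Fin n)) (J : Finset ℕ) (p : ℕ) :
    (allowedSigns σ J p).card = (if p ∈ descA σ ∧ p + 1 ∉ descA σ then 2 else 1) *
      if p ∉ descA σ ∧ p + 1 ∈ descA σ → (p ∈ J ↔ p + 1 ∉ J) then 1 else 0 := by
  unfold allowedSigns
  by_cases h1 : p ∈ descA σ <;> by_cases h2 : p + 1 ∈ descA σ <;>
  by_cases h3 : p ∈ J <;> by_cases h4 : p + 1 ∈ J <;>
  simp only [h1, h2, h3, h4] <;> decide

lemma descB_mk_eq_iff {ε : Fin n → ℤˣ} {σ : Equiv.Perm (Fin n)} {J : Finset ℕ}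
    (hJ : J ⊆ Finset.range n) :
    descB (⟨ε, σ⟩ : SignedPerm n) = J ↔ ∀ p : Fin n, ε (σ p) ∈ allowedSigns σ J p := by
  simp only [allowedSigns, Finset.mem_filter, Finset.mem_univ, true_and]
  constructor
  · rintro rfl p
    refine ⟨fun h => mem_descB_mk_of_notMem h p.2, fun h => mem_descB_mk_of_mem h p.2⟩
  · intro h
    ext k
    by_cases hk : k < n
    · by_cases hd : k ∈ descA σ
      · obtain ⟨k, rfl⟩ := Nat.exists_eq_add_of_le' (one_le_of_mem_descA hd)
        rw [mem_descB_mk_of_mem hd (by omega)]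
        exact ((h ⟨k, by omega⟩).2 hd).symm
      · rw [mem_descB_mk_of_notMem hd hk]
        exact ((h ⟨k, hk⟩).1 hd).symm
    · exact iff_of_false (fun h => hk (mem_descB.1 h).1) fun h => hk (by simpa using hJ h)

/-- Among the signings of `σ`, a set `J` of positions occurs as descent set if and only if exactly
one of `i - 1`, `i` belongs to `J` for every peak `i`. Then the signs of the letters in the valleys
are free, and the other signs are determined. -/
lemma card_signings (σ : Equiv.Perm (Fin n)) {J : Finset ℕ} (hJ : J ⊆ Finset.range n) :
    (Finset.univ.filter fun ε : Fin n → ℤˣ => descB (⟨ε, σ⟩ : SignedPerm n) = J).card =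
      if ∀ i ∈ Peak σ, (i - 1 ∈ J ↔ i ∉ J) then 2 ^ (Peak σ).card else 0 := by
  have h1 : (Finset.univ.filter fun ε : Fin n → ℤˣ => descB (⟨ε, σ⟩ : SignedPerm n) = J).card =
      (Fintype.piFinset fun p : Fin n => allowedSigns σ J p).card := by
    refine Finset.card_equiv (σ.symm.arrowCongr (Equiv.refl _)) fun ε => ?_
    rw [Finset.mem_filter, descB_mk_eq_iff hJ, Fintype.mem_piFinset]
    simp
  rw [h1, Fintype.card_piFinset, ← Finset.prod_range fun p => (allowedSigns σ J p).card]
  simp only [card_allowedSigns, Finset.prod_mul_distrib]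
  rw [Finset.prod_ite_zero, Finset.prod_ite, Finset.prod_const, Finset.prod_const_one, mul_one,
    card_valleys, Finset.prod_const_one, mul_ite, mul_one, mul_zero]
  refine if_congr ?_ rfl rfl
  constructor
  · intro h i hi
    cases i with
    | zero => exact absurd hi (zero_notMem_Peak σ)
    | succ k =>
      rw [succ_mem_Peak] at hi
      exact h k (Finset.mem_range.2 (by have := (mem_descA.1 hi.2).1; omega)) hi
  · intro h k _ hk
    exact h (k + 1) (succ_mem_Peak.2 hk)

end Signings

/-! ### The image of the descent algebra of type `B` -/

section ImageB

variable {n : ℕ}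

lemma descentAlgebra_generatorsB :
    descentAlgebra (generatorsB n) = fiberConst (descB (n := n)) := by
  rw [descentAlgebra_eq_fiberConst]
  exact fiberConst_congr Des_generatorsB_eq_iff

/-- `φ(Y_J)`, where `J` is given as a set of positions. -/
noncomputable def phiY (n : ℕ) (J : Finset ℕ) : MonoidAlgebra ℚ (Equiv.Perm (Fin n)) :=
  phi n (setSum {w : SignedPerm n | descB w = J})

lemma card_filter_right (σ : Equiv.Perm (Fin n)) (p : SignedPerm n → Prop) [DecidablePred p] :
    (Finset.univ.filter fun w : SignedPerm n => p w ∧ w.right = σ).card =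
      (Finset.univ.filter fun ε : Fin n → ℤˣ => p ⟨ε, σ⟩).card := by
  symm
  refine Finset.card_bij (fun ε _ => ⟨ε, σ⟩) ?_ ?_ ?_
  · intro ε hε
    simpa using hε
  · intro ε _ ε' _ h
    exact congrArg SemidirectProduct.left h
  · rintro ⟨ε, τ⟩ h
    simp only [Finset.mem_filter, Finset.mem_univ, true_and] at h
    obtain ⟨h1, rfl⟩ := h
    exact ⟨ε, by simpa using h1, rfl⟩

lemma coeff_phi_setSum (p : SignedPerm n → Prop) [DecidablePred p] (σ : Equiv.Perm (Fin n)) :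
    (phi n (setSum (Finset.univ.filter p))).coeff σ =
      (Finset.univ.filter fun ε : Fin n → ℤˣ => p ⟨ε, σ⟩).card := by
  rw [phi, coeff_map_setSum, Finset.filter_filter]
  exact congrArg _ (card_filter_right σ p)

lemma coeff_phiY {J : Finset ℕ} (hJ : J ⊆ Finset.range n) (σ : Equiv.Perm (Fin n)) :
    (phiY n J).coeff σ = if ∀ i ∈ Peak σ, (i - 1 ∈ J ↔ i ∉ J) then 2 ^ (Peak σ).card else 0 := by
  rw [phiY, coeff_phi_setSum, card_signings σ hJ]
  push_cast
  rfl

lemma map_phi_fiberConst_eq_span :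
    Submodule.map (phi n).toLinearMap (fiberConst (descB (n := n))) =
      Submodule.span ℚ {y | ∃ J ⊆ Finset.range n, y = phiY n J} := by
  rw [← span_setSum_fiber (descB (n := n)) (fun J => J ⊆ Finset.range n)
    (fun w => Finset.filter_subset _ _), Submodule.map_span]
  congr 1
  ext y
  simp only [Set.mem_image, Set.mem_ofPred_eq]
  constructor
  · rintro ⟨_, ⟨J, hJ, rfl⟩, rfl⟩
    exact ⟨J, hJ, rfl⟩
  · rintro ⟨J, hJ, rfl⟩
    exact ⟨_, ⟨J, hJ, rfl⟩, rfl⟩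

/-- Every set of positions `1 ≤ i < n` is the set of those for which exactly one of `i - 1`, `i`
belongs to a suitable set `J`. -/
lemma exists_boundary (n : ℕ) (F : Finset ℕ) :
    ∃ J ⊆ Finset.range n, ∀ i, 1 ≤ i → i < n → ((i - 1 ∈ J ↔ i ∉ J) ↔ i ∈ F) := by
  refine ⟨{k ∈ Finset.range n | Odd (F.filter fun i => 1 ≤ i ∧ i ≤ k).card},
    Finset.filter_subset _ _, fun i hi hin => ?_⟩
  obtain ⟨k, rfl⟩ := Nat.exists_eq_add_of_le' hi
  have h : F.filter (fun i => 1 ≤ i ∧ i ≤ k + 1) =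
      F.filter (fun i => 1 ≤ i ∧ i ≤ k) ∪ F.filter (· = k + 1) := by
    rw [← Finset.filter_or]
    exact Finset.filter_congr fun i _ => by omega
  have hd : Disjoint (F.filter (fun i => 1 ≤ i ∧ i ≤ k)) (F.filter (· = k + 1)) := by
    rw [Finset.disjoint_filter]
    intro i _ h
    omega
  simp only [Finset.mem_filter, Finset.mem_range, hin, Nat.add_sub_cancel, true_and,
    show k < n by omega]
  rw [h, Finset.card_union_of_disjoint hd, Finset.filter_eq']
  split_ifs with hF
  · simp only [Finset.card_singleton, hF, Nat.odd_add_one, not_not]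
  · simp only [Finset.card_empty, hF, iff_false, add_zero]
    tauto

/-- The transition from the `P_F` to suitable `φ(Y_J)` is triangular. -/
lemma setSum_Peak_mem_span_phiY (F : Finset ℕ) :
    setSum {σ : Equiv.Perm (Fin n) | Peak σ = F} ∈
      Submodule.span ℚ {y | ∃ J ⊆ Finset.range n, y = phiY n J} := by
  induction F using Finset.strongInduction with
  | H F ih =>
    obtain ⟨J, hJ, hF⟩ := exists_boundary n F
    have hcond : ∀ σ : Equiv.Perm (Fin n), (∀ i ∈ Peak σ, (i - 1 ∈ J ↔ i ∉ J)) ↔ Peak σ ⊆ F := by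
      intro σ
      refine forall₂_congr fun i hi => ?_
      have hi' : i ∈ Finset.Icc 1 (n - 1) := (Finset.mem_filter.1 hi).1
      rw [Finset.mem_Icc] at hi'
      exact hF i hi'.1 (by omega)
    have e : setSum {σ : Equiv.Perm (Fin n) | Peak σ = F} =
        ((2 : ℚ) ^ F.card)⁻¹ • (phiY n J - ∑ I ∈ F.ssubsets,
          (2 : ℚ) ^ I.card • setSum {σ : Equiv.Perm (Fin n) | Peak σ = I}) := by
      ext σ
      simp only [MonoidAlgebra.coeff_sub, MonoidAlgebra.coeff_sum, MonoidAlgebra.coeff_smul,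
        Finsupp.sub_apply, Finsupp.smul_apply, Finsupp.finsetSum_apply, coeff_setSum_filter,
        smul_eq_mul, mul_ite, mul_one, mul_zero, Finset.sum_ite_eq, Finset.mem_ssubsets,
        coeff_phiY hJ, hcond]
      by_cases h : Peak σ = F
      · simp [h]
      · simp [h, Finset.ssubset_iff_subset_ne]
    rw [e]
    refine Submodule.smul_mem _ _ (Submodule.sub_mem _ (Submodule.subset_span ⟨J, hJ, rfl⟩)
      (Submodule.sum_mem _ fun I hI => Submodule.smul_mem _ _ ?_))
    exact ih I (Finset.mem_ssubsets.1 hI)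

lemma span_phiY_eq_peakAlgebra :
    Submodule.span ℚ {y | ∃ J ⊆ Finset.range n, y = phiY n J} = peakAlgebra n := by
  rw [peakAlgebra_eq_fiberConst]
  apply le_antisymm
  · rw [Submodule.span_le]
    rintro _ ⟨J, hJ, rfl⟩ σ τ h
    rw [coeff_phiY hJ, coeff_phiY hJ, h]
  · rw [← span_setSum_fiber (Peak (n := n)) (fun _ => True) (fun _ => trivial), Submodule.span_le]
    rintro _ ⟨F, -, rfl⟩
    exact setSum_Peak_mem_span_phiY F

lemma map_phi_descentAlgebra :
    Submodule.map (phi n).toLinearMap (descentAlgebra (generatorsB n)) = peakAlgebra n := by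
  rw [descentAlgebra_generatorsB, map_phi_fiberConst_eq_span, span_phiY_eq_peakAlgebra]

lemma peakAlgebra_le_descentAlgebra : peakAlgebra n ≤ descentAlgebra (generatorsA n) := by
  rw [peakAlgebra_eq_fiberConst, descentAlgebra_eq_fiberConst]
  intro a ha σ τ h
  refine ha σ τ ?_
  have h' : descA σ = descA τ := (Des_generatorsA_eq_iff σ τ).1 h
  rw [Peak_eq_map_filter, h', ← Peak_eq_map_filter]

/-- Since `φ` is a homomorphism of algebras, the peak algebra inherits the multiplication from the
descent algebra of type `B`. -/
lemma exists_subalgebra_eq_peakAlgebra :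
    ∃ A : Subalgebra ℚ (MonoidAlgebra ℚ (Equiv.Perm (Fin n))),
      Subalgebra.toSubmodule A = peakAlgebra n := by
  let A : Subalgebra ℚ (MonoidAlgebra ℚ (SignedPerm n)) :=
    (fiberConst (descB (n := n))).toSubalgebra one_mem_fiberConst_descB
      fun _ _ => fiberConst_descB_mul_mem
  refine ⟨A.map (phi n), ?_⟩
  rw [← map_phi_descentAlgebra, descentAlgebra_generatorsB, Subalgebra.map_toSubmodule]
  rfl

end ImageB

/-! ### The image of the descent algebra of type `D` -/

section ImageD

variable {n : ℕ}

lemma letter_succ (σ : Equiv.Perm (Fin n)) {k : ℕ} (h : k < n) :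
    letter σ (k + 1) = (σ ⟨k, h⟩ : ℕ) + 1 := by
  rw [letter, dif_pos (by omega)]
  simp

lemma zero_mem_descD_mk_of_mem {ε : Fin n → ℤˣ} {σ : Equiv.Perm (Fin n)} (h : 1 ∈ descA σ)
    (hn : 0 < n) : 0 ∈ descD (⟨ε, σ⟩ : SignedPerm n) ↔ ε (σ ⟨0, hn⟩) = -1 := by
  obtain ⟨hn1, hlt⟩ : 1 < n ∧ letter σ 2 < letter σ 1 := mem_descA.1 h
  rw [zero_mem_descD hn, word_mk _ _ hn, word_mk _ _ hn1]
  rcases Int.units_eq_one_or (ε (σ ⟨0, hn⟩)) with h1 | h1 <;>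
  rcases Int.units_eq_one_or (ε (σ ⟨1, hn1⟩)) with h2 | h2 <;>
  rw [h1, h2] <;> simp <;> omega

lemma zero_mem_descD_mk_of_notMem {ε : Fin n → ℤˣ} {σ : Equiv.Perm (Fin n)} (h : 1 ∉ descA σ)
    (hn : 1 < n) : 0 ∈ descD (⟨ε, σ⟩ : SignedPerm n) ↔ ε (σ ⟨1, hn⟩) = -1 := by
  have hlt : letter σ 1 < letter σ 2 := (notMem_descA hn).1 h
  have hn0 : 0 < n := by omega
  rw [zero_mem_descD hn0, word_mk _ _ hn0, word_mk _ _ hn]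
  rcases Int.units_eq_one_or (ε (σ ⟨0, hn0⟩)) with h1 | h1 <;>
  rcases Int.units_eq_one_or (ε (σ ⟨1, hn⟩)) with h2 | h2 <;>
  rw [h1, h2] <;> simp <;> omega

lemma descD_eq_descB_of_mem {σ : Equiv.Perm (Fin n)} (h : 1 ∈ descA σ) (ε : Fin n → ℤˣ) :
    descD (⟨ε, σ⟩ : SignedPerm n) = descB (⟨ε, σ⟩ : SignedPerm n) := by
  have hn : 0 < n := by have := (mem_descA.1 h).1; omega
  have h0 : 0 ∉ descA σ := fun h => by simpa using one_le_of_mem_descA h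
  ext k
  by_cases hk : k = 0
  · rw [hk, zero_mem_descD_mk_of_mem h hn, mem_descB_mk_of_notMem h0 hn]
  · exact mem_descD_of_ne_zero hk

lemma zero_mem_descD_iff_of_notMem {σ : Equiv.Perm (Fin n)} (h : 1 ∉ descA σ) (hn : 1 < n)
    (ε : Fin n → ℤˣ) :
    0 ∈ descD (⟨ε, σ⟩ : SignedPerm n) ↔ 1 ∈ descB (⟨ε, σ⟩ : SignedPerm n) := by
  rw [zero_mem_descD_mk_of_notMem h hn, mem_descB_mk_of_notMem h hn]

/-- The sign of the smallest letter is irrelevant for the descents in type `D`. -/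
lemma descD_mk_congr {ε ε' : Fin n → ℤˣ} (hn : 2 ≤ n) (h : ∀ i : Fin n, (i : ℕ) ≠ 0 → ε i = ε' i)
    (σ : Equiv.Perm (Fin n)) :
    descD (⟨ε, σ⟩ : SignedPerm n) = descD (⟨ε', σ⟩ : SignedPerm n) := by
  have hB : ∀ k, k ≠ 0 → (k ∈ descB (⟨ε, σ⟩ : SignedPerm n) ↔
      k ∈ descB (⟨ε', σ⟩ : SignedPerm n)) := by
    intro k hk
    by_cases hkn : k < n
    · cases k with
      | zero => exact absurd rfl hk
      | succ k =>
        have hkn' : k < n := by omega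
        by_cases hd : k + 1 ∈ descA σ
        · rw [mem_descB_mk_of_mem hd hkn', mem_descB_mk_of_mem hd hkn', h]
          have := (mem_descA.1 hd).2
          rw [letter_succ σ hkn, letter_succ σ hkn'] at this
          omega
        · rw [mem_descB_mk_of_notMem hd hkn, mem_descB_mk_of_notMem hd hkn, h]
          have := (notMem_descA hkn).1 hd
          rw [letter_succ σ hkn, letter_succ σ hkn'] at this
          omega
    · simp [mem_descB, hkn]
  ext k
  by_cases hk : k = 0
  · subst hk
    by_cases hd : 1 ∈ descA σ
    · have hn0 : 0 < n := by omega
      rw [zero_mem_descD_mk_of_mem hd hn0, zero_mem_descD_mk_of_mem hd hn0, h]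
      have := (mem_descA.1 hd).2
      rw [letter_succ σ (show 1 < n by omega), letter_succ σ hn0] at this
      omega
    · rw [zero_mem_descD_iff_of_notMem hd (by omega), zero_mem_descD_iff_of_notMem hd (by omega)]
      exact hB 1 one_ne_zero
  · rw [mem_descD_of_ne_zero hk, mem_descD_of_ne_zero hk]
    exact hB k hk

/-- Half of the signings with given descents in type `D` are even. -/
lemma two_mul_card_even_signings (hn : 2 ≤ n) (σ : Equiv.Perm (Fin n)) (J : Finset ℕ) :
    2 * (Finset.univ.filter fun ε : Fin n → ℤˣ =>
      ∏ i, ε i = 1 ∧ descD (⟨ε, σ⟩ : SignedPerm n) = J).card =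
      (Finset.univ.filter fun ε : Fin n → ℤˣ => descD (⟨ε, σ⟩ : SignedPerm n) = J).card := by
  set c : Fin n → ℤˣ := Pi.mulSingle ⟨0, by omega⟩ (-1) with hc
  have hprod : ∏ i, c i = -1 := by simp [hc]
  have hodd : (Finset.univ.filter fun ε : Fin n → ℤˣ =>
      ∏ i, ε i = 1 ∧ descD (⟨ε, σ⟩ : SignedPerm n) = J).card =
      (Finset.univ.filter fun ε : Fin n → ℤˣ =>
        ¬ ∏ i, ε i = 1 ∧ descD (⟨ε, σ⟩ : SignedPerm n) = J).card := by
    refine Finset.card_equiv (Equiv.mulLeft c) fun ε => ?_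
    have h1 : descD (⟨c * ε, σ⟩ : SignedPerm n) = descD (⟨ε, σ⟩ : SignedPerm n) := by
      refine descD_mk_congr hn (fun i hi => ?_) σ
      rw [Pi.mul_apply, hc, Pi.mulSingle_eq_of_ne, one_mul]
      exact fun e => hi (congrArg Fin.val e)
    simp only [Finset.mem_filter, Finset.mem_univ, true_and, Equiv.coe_mulLeft, h1, Pi.mul_apply,
      Finset.prod_mul_distrib, hprod]
    refine and_congr_left fun _ => ?_
    rcases Int.units_eq_one_or (∏ i, ε i) with h | h <;> rw [h] <;> decide
  rw [two_mul]
  conv_lhs => rw [hodd]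
  rw [← Finset.card_filter_add_card_filter_not (fun ε : Fin n → ℤˣ => ∏ i, ε i = 1)
    (s := Finset.univ.filter fun ε : Fin n → ℤˣ => descD (⟨ε, σ⟩ : SignedPerm n) = J),
    Finset.filter_filter, Finset.filter_filter]
  simp only [and_comm, ← hodd]

/-- The set `J` with the membership of `0` reversed. -/
def toggleZero (J : Finset ℕ) : Finset ℕ := symmDiff J {0}

lemma zero_mem_toggleZero {J : Finset ℕ} : 0 ∈ toggleZero J ↔ 0 ∉ J := by
  simp [toggleZero, Finset.mem_symmDiff]

lemma mem_toggleZero_of_ne_zero {J : Finset ℕ} {k : ℕ} (hk : k ≠ 0) :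
    k ∈ toggleZero J ↔ k ∈ J := by
  simp [toggleZero, Finset.mem_symmDiff, hk]

lemma toggleZero_subset_range {J : Finset ℕ} (hn : 0 < n) (hJ : J ⊆ Finset.range n) :
    toggleZero J ⊆ Finset.range n := by
  intro k hk
  by_cases h : k = 0
  · simpa [h] using hn
  · exact hJ ((mem_toggleZero_of_ne_zero h).1 hk)

lemma toggleZero_ne (J : Finset ℕ) : toggleZero J ≠ J := by
  intro h
  have := zero_mem_toggleZero (J := J)
  rw [h] at this
  tauto

/-- `ψ(Y_J)`, where `J` is given as a set of positions. -/
noncomputable def psiY (n : ℕ) (J : Finset ℕ) : MonoidAlgebra ℚ (Equiv.Perm (Fin n)) :=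
  psi n (setSum {w : evenSignedPerm n | descD (w : SignedPerm n) = J})

lemma two_mul_coeff_psiY (hn : 2 ≤ n) (J : Finset ℕ) (σ : Equiv.Perm (Fin n)) :
    2 * (psiY n J).coeff σ =
      (Finset.univ.filter fun ε : Fin n → ℤˣ => descD (⟨ε, σ⟩ : SignedPerm n) = J).card := by
  rw [← two_mul_card_even_signings hn, psiY, psi, coeff_map_setSum, Finset.filter_filter]
  push_cast
  congr 2
  symm
  refine Finset.card_bij
    (fun ε hε => ⟨⟨ε, σ⟩, (Finset.mem_filter.1 hε).2.1⟩) ?_ ?_ ?_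
  · intro ε hε
    exact Finset.mem_filter.2 ⟨Finset.mem_univ _, (Finset.mem_filter.1 hε).2.2, rfl⟩
  · intro ε _ ε' _ h
    exact congrArg (fun w : evenSignedPerm n => (w : SignedPerm n).left) h
  · rintro ⟨⟨ε, τ⟩, hw⟩ h
    simp only [Finset.mem_filter, Finset.mem_univ, true_and] at h
    obtain ⟨h1, rfl⟩ := h
    exact ⟨ε, Finset.mem_filter.2 ⟨Finset.mem_univ _, hw, h1⟩, rfl⟩

/-- If `w_1 < w_2`, then the two generators at the beginning of the word are descents in type `D`
at the same time, and the first sign, which decides about the descent `0` in type `B`, is free. -/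
lemma card_filter_descD_of_notMem {σ : Equiv.Perm (Fin n)} (h : 1 ∉ descA σ) (hn : 1 < n)
    (J : Finset ℕ) :
    (Finset.univ.filter fun ε : Fin n → ℤˣ => descD (⟨ε, σ⟩ : SignedPerm n) = J).card =
      if 0 ∈ J ↔ 1 ∈ J then
        (Finset.univ.filter fun ε : Fin n → ℤˣ => descB (⟨ε, σ⟩ : SignedPerm n) = J).card +
        (Finset.univ.filter fun ε : Fin n → ℤˣ =>
          descB (⟨ε, σ⟩ : SignedPerm n) = toggleZero J).card
      else 0 := by
  have h01 := zero_mem_descD_iff_of_notMem h hn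
  split_ifs with hJ
  · rw [← Finset.card_union_of_disjoint, ← Finset.filter_or]
    · congr 1
      refine Finset.filter_congr fun ε _ => ?_
      constructor
      · rintro rfl
        by_cases h0 : 0 ∈ descB (⟨ε, σ⟩ : SignedPerm n) ↔ 0 ∈ descD (⟨ε, σ⟩ : SignedPerm n)
        · left
          ext k
          by_cases hk : k = 0
          · rw [hk, h0]
          · rw [mem_descD_of_ne_zero hk]
        · right
          ext k
          by_cases hk : k = 0
          · rw [hk, zero_mem_toggleZero]
            tauto
          · rw [mem_toggleZero_of_ne_zero hk, mem_descD_of_ne_zero hk]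
      · intro hor
        have hk : ∀ k ≠ 0, (k ∈ descB (⟨ε, σ⟩ : SignedPerm n) ↔ k ∈ J) := by
          intro k hk
          rcases hor with e | e
          · rw [e]
          · rw [e, mem_toggleZero_of_ne_zero hk]
        ext k
        by_cases hk0 : k = 0
        · rw [hk0, h01, hk 1 one_ne_zero, hJ]
        · rw [mem_descD_of_ne_zero hk0, hk k hk0]
    · rw [Finset.disjoint_filter]
      intro ε _ h1 h2
      exact toggleZero_ne J (h2.symm.trans h1)
  · rw [Finset.card_eq_zero, Finset.filter_eq_empty_iff]
    rintro ε - rfl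
    rw [mem_descD_of_ne_zero one_ne_zero] at hJ
    exact hJ (h01 ε)

lemma psiY_eq (hn : 2 ≤ n) {J : Finset ℕ} (hJ : J ⊆ Finset.range n) :
    psiY n J = if 0 ∈ J ↔ 1 ∈ J then phiY n J
      else (2⁻¹ : ℚ) • (phiY n J - phiY n (toggleZero J)) := by
  have hJ' := toggleZero_subset_range (by omega) hJ
  ext σ
  have h2 := two_mul_coeff_psiY hn J σ
  have hB : ∀ I, ((Finset.univ.filter fun ε : Fin n → ℤˣ =>
      descB (⟨ε, σ⟩ : SignedPerm n) = I).card : ℚ) = (phiY n I).coeff σ := by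
    intro I
    rw [phiY, coeff_phi_setSum]
  by_cases hd : 1 ∈ descA σ
  -- The peak `1` excludes those `J` that contain both or none of `0`, `1`.
  · have hp := one_mem_Peak_iff.2 hd
    have hz : ∀ I ⊆ Finset.range n, (0 ∈ I ↔ 1 ∈ I) → (phiY n I).coeff σ = 0 := by
      intro I hI h01
      rw [coeff_phiY hI, if_neg]
      intro hall
      have := hall 1 hp
      rw [Nat.sub_self] at this
      tauto
    simp only [descD_eq_descB_of_mem hd] at h2
    rw [hB J] at h2
    split_ifs with h01
    · rw [hz J hJ h01] at h2 ⊢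
      linarith
    · have := hz _ hJ' (by
        rw [zero_mem_toggleZero, mem_toggleZero_of_ne_zero one_ne_zero]
        tauto)
      simp only [MonoidAlgebra.coeff_smul, MonoidAlgebra.coeff_sub, Finsupp.smul_apply,
        Finsupp.sub_apply, this, smul_eq_mul]
      linarith
  -- Without the peak `1`, the membership of `0` in `J` is irrelevant.
  · have ht : (phiY n (toggleZero J)).coeff σ = (phiY n J).coeff σ := by
      rw [coeff_phiY hJ, coeff_phiY hJ']
      refine if_congr (forall₂_congr fun i hi => ?_) rfl rfl
      have h0 : i ≠ 0 := fun e => zero_notMem_Peak σ (e ▸ hi)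
      have h1 : i ≠ 1 := fun e => hd (one_mem_Peak_iff.1 (e ▸ hi))
      rw [mem_toggleZero_of_ne_zero h0, mem_toggleZero_of_ne_zero (by omega)]
    rw [card_filter_descD_of_notMem hd (by omega)] at h2
    split_ifs at h2 ⊢ with h01
    · rw [Nat.cast_add, hB J, hB _, ht] at h2
      linarith
    · simp only [MonoidAlgebra.coeff_smul, MonoidAlgebra.coeff_sub, Finsupp.smul_apply,
        Finsupp.sub_apply, ht, sub_self, smul_zero]
      simpa using h2

lemma map_psi_fiberConst_eq_span :
    Submodule.map (psi n).toLinearMap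
      (fiberConst fun w : evenSignedPerm n => descD (w : SignedPerm n)) =
      Submodule.span ℚ {y | ∃ J ⊆ Finset.range n, y = psiY n J} := by
  rw [← span_setSum_fiber (fun w : evenSignedPerm n => descD (w : SignedPerm n))
    (fun J => J ⊆ Finset.range n) (fun w => Finset.filter_subset _ _), Submodule.map_span]
  congr 1
  ext y
  simp only [Set.mem_image, Set.mem_ofPred_eq]
  constructor
  · rintro ⟨_, ⟨J, hJ, rfl⟩, rfl⟩
    exact ⟨J, hJ, rfl⟩
  · rintro ⟨J, hJ, rfl⟩
    exact ⟨_, ⟨J, hJ, rfl⟩, rfl⟩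

lemma span_psiY_eq_span_phiY (hn : 2 ≤ n) :
    Submodule.span ℚ {y | ∃ J ⊆ Finset.range n, y = psiY n J} =
      Submodule.span ℚ {y | ∃ J ⊆ Finset.range n, y = phiY n J} := by
  apply le_antisymm <;> rw [Submodule.span_le] <;> rintro _ ⟨J, hJ, rfl⟩
  all_goals have hJ' := toggleZero_subset_range (by omega) hJ
  · rw [psiY_eq hn hJ]
    split_ifs
    · exact Submodule.subset_span ⟨J, hJ, rfl⟩
    · exact Submodule.smul_mem _ _ (Submodule.sub_mem _ (Submodule.subset_span ⟨J, hJ, rfl⟩)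
        (Submodule.subset_span ⟨_, hJ', rfl⟩))
  · by_cases h01 : 0 ∈ J ↔ 1 ∈ J
    · exact Submodule.subset_span ⟨J, hJ, by rw [psiY_eq hn hJ, if_pos h01]⟩
    · have e : phiY n J = (2 : ℚ) • psiY n J + psiY n (toggleZero J) := by
        rw [psiY_eq hn hJ, psiY_eq hn hJ', if_neg h01, if_pos, smul_smul]
        · norm_num
        · rw [zero_mem_toggleZero, mem_toggleZero_of_ne_zero one_ne_zero]
          tauto
      rw [e]
      exact Submodule.add_mem _ (Submodule.smul_mem _ _ (Submodule.subset_span ⟨J, hJ, rfl⟩))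
        (Submodule.subset_span ⟨_, hJ', rfl⟩)

lemma map_psi_descentAlgebra :
    Submodule.map (psi n).toLinearMap (descentAlgebra (generatorsD n)) = peakAlgebra n := by
  rcases Nat.lt_or_ge n 2 with hn | hn
  -- For `n ≤ 1` all the groups involved are trivial.
  · have : Subsingleton (Fin n) := Fin.subsingleton_iff_le_one.2 (by omega)
    have hsub : Subsingleton (evenSignedPerm n) := by
      have key : ∀ w : evenSignedPerm n, w = 1 := by
        rintro ⟨⟨ε, σ⟩, hw⟩
        have hw' : ∏ i, ε i = 1 := hw
        refine Subtype.ext (SemidirectProduct.ext (funext fun i => ?_) (Subsingleton.elim _ _))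
        rwa [Fintype.prod_subsingleton _ i] at hw'
      exact ⟨fun a b => (key a).trans (key b).symm⟩
    rw [descentAlgebra_eq_fiberConst, peakAlgebra_eq_fiberConst]
    have h1 : fiberConst (Des (generatorsD n)) = ⊤ :=
      eq_top_iff.2 fun a _ x y _ => by rw [Subsingleton.elim x y]
    have h2 : fiberConst (Peak (n := n)) = ⊤ :=
      eq_top_iff.2 fun a _ x y _ => by rw [Subsingleton.elim x y]
    rw [h1, h2, eq_top_iff]
    intro a _
    refine ⟨MonoidAlgebra.single 1 (a.coeff 1), trivial, ?_⟩
    refine MonoidAlgebra.ext (Finsupp.ext fun σ => ?_)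
    rw [Subsingleton.elim σ 1]
    simp [psi]
  · rw [descentAlgebra_eq_fiberConst, fiberConst_congr (Des_generatorsD_eq_iff hn),
      map_psi_fiberConst_eq_span, span_psiY_eq_span_phiY hn, span_phiY_eq_peakAlgebra]

end ImageD

/-! ### The dimension of the peak algebra -/

section Dimension

variable {n : ℕ}

lemma mem_sparseSets {F : Finset ℕ} :
    F ∈ sparseSets n ↔ (∀ i ∈ F, 1 ≤ i ∧ i + 1 ≤ n) ∧ ∀ i ∈ F, i + 1 ∉ F := by
  simp only [sparseSets, Finset.mem_filter, Finset.mem_powerset, Finset.subset_iff, Finset.mem_Icc]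
  refine and_congr_left fun _ => forall₂_congr fun i _ => by omega

/-- The word obtained from `1 2 … n` by exchanging the letters `i`, `i + 1` for all `i ∈ F` has the
peak set `F`. -/
lemma exists_Peak_eq {F : Finset ℕ} (hF : F ∈ sparseSets n) :
    ∃ w : Equiv.Perm (Fin n), Peak w = F := by
  obtain ⟨h1, h2⟩ := mem_sparseSets.1 hF
  -- `k : Fin n` is the symbol, and the position, of number `k + 1`.
  let f : Fin n → Fin n := fun k =>
    if h : (k : ℕ) + 1 ∈ F then ⟨k + 1, (h1 _ h).2⟩
    else if (k : ℕ) ∈ F then ⟨k - 1, by omega⟩ else k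
  have hf : ∀ k, (f k : ℕ) =
      if (k : ℕ) + 1 ∈ F then (k : ℕ) + 1 else if (k : ℕ) ∈ F then (k : ℕ) - 1 else k := by
    intro k
    simp only [f]
    split_ifs <;> rfl
  have hinv : Function.Involutive f := by
    intro k
    apply Fin.ext
    rw [hf, hf]
    by_cases ha : (k : ℕ) + 1 ∈ F
    · simp [ha, h2 _ ha]
    · by_cases hb : (k : ℕ) ∈ F
      · have := (h1 _ hb).1
        simp [ha, hb, Nat.sub_add_cancel this]
      · simp [ha, hb]
  have hl : ∀ k, k < n → letter hinv.toPerm (k + 1) =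
      if k + 1 ∈ F then k + 2 else if k ∈ F then k else k + 1 := by
    intro k hk
    rw [letter_succ _ hk, Function.Involutive.coe_toPerm, hf]
    simp only
    split_ifs with ha hb
    · rfl
    · have := (h1 _ hb).1
      omega
    · rfl
  refine ⟨hinv.toPerm, ?_⟩
  ext i
  cases i with
  | zero =>
    refine iff_of_false (zero_notMem_Peak _) fun h => ?_
    have := (h1 _ h).1
    omega
  | succ k =>
    rw [Peak, Finset.mem_filter, Finset.mem_Icc, Nat.add_sub_cancel]
    constructor
    · rintro ⟨hk, -, hb⟩
      by_contra hc
      rw [hl _ (by omega), hl _ (by omega), if_neg hc, if_neg hc] at hb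
      split_ifs at hb <;> omega
    · intro hk
      have hk1 := h1 _ hk
      have hk2 := h2 _ hk
      refine ⟨by omega, ?_, ?_⟩
      · cases k with
        | zero => rw [hl _ (by omega), if_pos hk]; simp [letter]
        | succ k =>
          have hk3 : k + 1 ∉ F := fun h => h2 _ h hk
          rw [hl _ (by omega), hl _ (by omega), if_pos hk, if_neg hk3]
          split_ifs <;> omega
      · rw [hl _ (by omega), hl _ (by omega), if_pos hk, if_neg hk2, if_pos hk]
        omega

lemma finrank_peakAlgebra : Module.finrank ℚ (peakAlgebra n) = (sparseSets n).card := by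
  have hli : LinearIndependent ℚ fun F : sparseSets n => P n F := by
    rw [Fintype.linearIndependent_iff]
    intro c hc F
    obtain ⟨w, hw⟩ := exists_Peak_eq F.2
    have h := congrArg (fun a => MonoidAlgebra.coeff a w) hc
    have hP : ∀ I : Finset ℕ, (P n I).coeff w = if Peak w = I then 1 else 0 :=
      fun I => coeff_setSum_filter (fun w => Peak w = I) w
    simp only [MonoidAlgebra.coeff_sum, MonoidAlgebra.coeff_smul, Finsupp.finsetSum_apply,
      Finsupp.smul_apply, hP, hw, smul_eq_mul, mul_ite, mul_one, mul_zero] at h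
    rw [Finset.sum_eq_single F (fun I _ hI => if_neg fun e => hI (Subtype.ext e.symm))
      (fun hI => absurd (Finset.mem_univ F) hI), if_pos rfl] at h
    exact h
  have hspan : peakAlgebra n = Submodule.span ℚ (Set.range fun F : sparseSets n => P n F) := by
    rw [peakAlgebra]
    congr 1
    ext p
    constructor
    · rintro ⟨F, hF, rfl⟩
      exact ⟨⟨F, hF⟩, rfl⟩
    · rintro ⟨F, rfl⟩
      exact ⟨F, F.2, rfl⟩
  rw [hspan, finrank_span_eq_card hli, Fintype.card_coe]

lemma sparseSets_add_two (n : ℕ) :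
    sparseSets (n + 2) = sparseSets (n + 1) ∪ (sparseSets n).image (insert (n + 1)) := by
  ext F
  rw [Finset.mem_union, Finset.mem_image]
  simp only [mem_sparseSets]
  constructor
  · rintro ⟨h1, h2⟩
    by_cases hF : n + 1 ∈ F
    · right
      refine ⟨F.erase (n + 1), ⟨fun i hi => ?_, fun i hi hi' => ?_⟩, Finset.insert_erase hF⟩
      · obtain ⟨hne, hi⟩ := Finset.mem_erase.1 hi
        have := h1 i hi
        have hin : i ≠ n := fun e => h2 i hi (e ▸ hF)
        omega
      · exact h2 i (Finset.mem_of_mem_erase hi) (Finset.mem_of_mem_erase hi')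
    · left
      refine ⟨fun i hi => ?_, h2⟩
      have := h1 i hi
      have hin : i ≠ n + 1 := fun e => hF (e ▸ hi)
      omega
  · rintro (⟨h1, h2⟩ | ⟨G, ⟨h1, h2⟩, rfl⟩)
    · refine ⟨fun i hi => ?_, h2⟩
      have := h1 i hi
      omega
    · refine ⟨fun i hi => ?_, fun i hi hi' => ?_⟩
      · rcases Finset.mem_insert.1 hi with rfl | hi
        · omega
        · have := h1 i hi
          omega
      · rcases Finset.mem_insert.1 hi with rfl | hi <;> rcases Finset.mem_insert.1 hi' with e | hi'
        · omega
        · have := h1 _ hi'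
          omega
        · have := h1 _ hi
          omega
        · exact h2 i hi hi'

lemma card_sparseSets : ∀ n : ℕ, (sparseSets n).card = Nat.fib (n + 1)
  | 0 => by decide
  | 1 => by decide
  | n + 2 => by
    rw [sparseSets_add_two, Finset.card_union_of_disjoint, Finset.card_image_of_injOn,
      card_sparseSets n, card_sparseSets (n + 1), Nat.fib_add_two (n := n + 1), add_comm]
    · intro F hF G hG h
      have hF' : n + 1 ∉ F := fun h => by have := (mem_sparseSets.1 hF).1 _ h; omega
      have hG' : n + 1 ∉ G := fun h => by have := (mem_sparseSets.1 hG).1 _ h; omega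
      rw [← Finset.erase_insert hF', ← Finset.erase_insert hG']
      exact congrArg (fun s => Finset.erase s (n + 1)) h
    · rw [Finset.disjoint_right]
      intro F hF hF'
      obtain ⟨G, -, rfl⟩ := Finset.mem_image.1 hF
      have := (mem_sparseSets.1 hF').1 _ (Finset.mem_insert_self _ _)
      omega

end Dimension

end PeakAlgebra

theorem mainTheorem1 (n : ℕ) :
    -- the span of the `P_F` is a unital subalgebra of the group algebra
    (∃ A : Subalgebra ℚ (MonoidAlgebra ℚ (Equiv.Perm (Fin n))),
      Subalgebra.toSubmodule A = PeakAlgebra.peakAlgebra n) ∧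
    -- it is contained in the descent algebra of the symmetric group
    PeakAlgebra.peakAlgebra n ≤ PeakAlgebra.descentAlgebra (PeakAlgebra.generatorsA n) ∧
    -- its dimension is the Fibonacci number `f_n`, where `f_0 = f_1 = 1`
    Module.finrank ℚ (PeakAlgebra.peakAlgebra n) = (PeakAlgebra.sparseSets n).card ∧
    (PeakAlgebra.sparseSets n).card = Nat.fib (n + 1) ∧
    -- it is the image of the descent algebra of type `B`
    Submodule.map (PeakAlgebra.phi n).toLinearMap
      (PeakAlgebra.descentAlgebra (PeakAlgebra.generatorsB n)) = PeakAlgebra.peakAlgebra n ∧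
    -- and the image of the descent algebra of type `D`
    Submodule.map (PeakAlgebra.psi n).toLinearMap
      (PeakAlgebra.descentAlgebra (PeakAlgebra.generatorsD n)) = PeakAlgebra.peakAlgebra n := by
  exact ⟨PeakAlgebra.exists_subalgebra_eq_peakAlgebra, PeakAlgebra.peakAlgebra_le_descentAlgebra,
    PeakAlgebra.finrank_peakAlgebra, PeakAlgebra.card_sparseSets n,
    PeakAlgebra.map_phi_descentAlgebra, PeakAlgebra.map_psi_descentAlgebra⟩
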